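/- **Setting.** All alphabets are finite, logarithms are to base 2, and all entropies and mutual informations are in bits. A discrete memoryless two-user interference channel with an external eavesdropper (IC-EE) is given by finite sets $\mathcal X_1,\mathcal X_2,\mathcal Y_1,\mathcal Y_2,\mathcal Y_e$ and a conditional distribution $p(y_1,y_2,y_e|x_1,x_2)$; over $n$ uses the outputs have law $\prod_{i=1}^n p(y_1(i),y_2(i),y_e(i)|x_1(i),x_2(i))$. **Codes and capacity.** An $(n,M_1,M_2)$ secret code consists of message sets $\mathcal W_k=\{1,\dots,M_k\}$, stochastic encoders $f_k$ (for each $w_k\in\mathcal W_k$ a distribution of the input sequence $\mathbf X_k\in\mathcal X_k^n$, the two encoders using independent randomness), and decoders $\phi_k:\mathcal Y_k^n\to\mathcal W_k$, $k=1,2$. Put $$P_{e,k}=\frac1{M_1M_2}\sum_{(w_1,w_2)\in\mathcal W_1\times\mathcal W_2}\Pr\{\phi_k(\mathbf Y_k)\ne w_k\mid (w_1,w_2)\text{ is sent}\},$$ and let $H(W_1,W_2|\mathbf Y_e)$ be the equivocation at the eavesdropper when $(W_1,W_2)$ is uniform on $\mathcal W_1\times\mathcal W_2$. A pair $(R_1,R_2)$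 with $R_1,R_2\ge0$ is achievable if for every $\epsilon>0$ and all sufficiently large $n$ there is an $(n,\lceil 2^{nR_1}\rceil,\lceil 2^{nR_2}\rceil)$ secret code with $$\max\{P_{e,1},P_{e,2}\}\le\epsilon,\qquad R_1+R_2-\frac1nH(W_1,W_2|\mathbf Y_e)\le\epsilon .$$ The secrecy capacity region $\mathbb C^{\text{IC-EE}}$ is the closure in $\mathbb R^2$ of the set of achievable pairs. **Rate region.** Let $\mathcal P$ be the set of all joint distributions $p$ of random variables $Q,C_1,S_1,O_1,C_2,S_2,O_2$ (with values in arbitrary finite sets), $X_1,X_2,Y_1,Y_2,Y_e$ that factor as $$p(q)\,p(c_1|q)p(s_1|q)p(o_1|q)\,p(c_2|q)p(s_2|q)p(o_2|q)\,p(x_1|c_1,s_1,o_1,q)\,p(x_2|c_2,s_2,o_2,q)\,p(y_1,y_2,y_e|x_1,x_2),$$ the last factor being the channel. Write $(T_1,\dots,T_6)=(C_1,S_1,O_1,C_2,S_2,O_2)$ and $T_{\mathcal S}=(T_i)_{i\in\mathcal S}$. For $p\in\mathcal P$, let $\mathcal R(p)$ be the closure of the set of all pairs $(R_1,R_2)=(R_{C_1}+R_{S_1},\,R_{C_2}+R_{S_2})$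 for which there are real numbers $R_{T_i}\ge0$ and $R_{T_i}^x\ge0$, $1\le i\le 6$, with $R_{O_1}=R_{O_2}=0$, such that $$\sum_{i\in\mathcal S}(R_{T_i}+R^x_{T_i})\le I(T_{\mathcal S};Y_1|T_{\{1,2,4,6\}\setminus\mathcal S},Q)\quad\text{for all }\mathcal S\subseteq\{1,2,4,6\},$$ $$\sum_{i\in\mathcal S}(R_{T_i}+R^x_{T_i})\le I(T_{\mathcal S};Y_2|T_{\{1,3,4,5\}\setminus\mathcal S},Q)\quad\text{for all }\mathcal S\subseteq\{1,3,4,5\},$$ $$\sum_{i\in\mathcal S}R^x_{T_i}\le I(T_{\mathcal S};Y_e|T_{\{1,\dots,6\}\setminus\mathcal S},Q)\quad\text{for all }\mathcal S\subsetneq\{1,\dots,6\},$$ $$\sum_{i=1}^6R^x_{T_i}=I(T_1,\dots,T_6;Y_e|Q).$$ **Theorem.** For every discrete memoryless IC-EE, the closure of $\bigcup_{p\in\mathcal P}\mathcal R(p)$ is contained in $\mathbb C^{\text{IC-EE}}$. -/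

import Mathlib

open scoped Classical in
/-- `Pr[f = a]` for a random variable `f` on a finite space with mass function `p`. -/
noncomputable def marginal {Ω α : Type*} [Fintype Ω] (p : Ω → ℝ) (f : Ω → α) (a : α) : ℝ :=
  ∑ ω with f ω = a, p ω

/-- Shannon entropy `H(f)` in bits. -/
noncomputable def entropy {Ω α : Type*} [Fintype Ω] [Fintype α] (p : Ω → ℝ) (f : Ω → α) : ℝ :=
  (∑ a, Real.negMulLog (marginal p f a)) / Real.log 2

/-- Conditional entropy `H(f | g) = H(f, g) - H(g)` in bits. -/
noncomputable def condEntropy {Ω α β : Type*} [Fintype Ω] [Fintype α] [Fintype β]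
    (p : Ω → ℝ) (f : Ω → α) (g : Ω → β) : ℝ :=
  entropy p (fun ω => (f ω, g ω)) - entropy p g

/-- Conditional mutual information `I(f; g | h) = H(f | h) - H(f | g, h)` in bits. -/
noncomputable def condMutualInfo {Ω α β γ : Type*}
    [Fintype Ω] [Fintype α] [Fintype β] [Fintype γ]
    (p : Ω → ℝ) (f : Ω → α) (g : Ω → β) (h : Ω → γ) : ℝ :=
  condEntropy p f h - condEntropy p f (fun ω => (g ω, h ω))

/-- A discrete memoryless two-user interference channel with an external eavesdropper: the
transition law `p(y₁, y₂, yₑ | x₁, x₂)`. -/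
abbrev Channel (𝒳₁ 𝒳₂ 𝒴₁ 𝒴₂ 𝒴ₑ : Type*) [Fintype 𝒴₁] [Fintype 𝒴₂] [Fintype 𝒴ₑ] :=
  𝒳₁ → 𝒳₂ → stdSimplex ℝ (𝒴₁ × 𝒴₂ × 𝒴ₑ)

/-- A secret code of length `n` with `M₁`, `M₂` messages. The encoders are stochastic, with
private randomness at each transmitter. -/
structure SecretCode (𝒳₁ 𝒳₂ 𝒴₁ 𝒴₂ : Type*) [Fintype 𝒳₁] [Fintype 𝒳₂] (n M₁ M₂ : ℕ) where
  enc₁ : Fin M₁ → stdSimplex ℝ (Fin n → 𝒳₁)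
  enc₂ : Fin M₂ → stdSimplex ℝ (Fin n → 𝒳₂)
  dec₁ : (Fin n → 𝒴₁) → Fin M₁
  dec₂ : (Fin n → 𝒴₂) → Fin M₂

section Code

variable {𝒳₁ 𝒳₂ 𝒴₁ 𝒴₂ 𝒴ₑ : Type*} [Fintype 𝒳₁] [Fintype 𝒳₂]
  [Fintype 𝒴₁] [Fintype 𝒴₂] [Fintype 𝒴ₑ] {n M₁ M₂ : ℕ}

/-- Conditional law of the received sequences `(𝐘₁, 𝐘₂, 𝐘ₑ)` given that `(w₁, w₂)` is sent over
`n` uses of the memoryless channel `W`. -/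
noncomputable def SecretCode.outputLaw (c : SecretCode 𝒳₁ 𝒳₂ 𝒴₁ 𝒴₂ n M₁ M₂)
    (W : Channel 𝒳₁ 𝒳₂ 𝒴₁ 𝒴₂ 𝒴ₑ) (w₁ : Fin M₁) (w₂ : Fin M₂)
    (y : (Fin n → 𝒴₁) × (Fin n → 𝒴₂) × (Fin n → 𝒴ₑ)) : ℝ :=
  ∑ x₁ : Fin n → 𝒳₁, ∑ x₂ : Fin n → 𝒳₂,
    c.enc₁ w₁ x₁ * c.enc₂ w₂ x₂ * ∏ i, W (x₁ i) (x₂ i) (y.1 i, y.2.1 i, y.2.2 i)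

/-- Average error probability of receiver 1. -/
noncomputable def SecretCode.errorProb₁ (c : SecretCode 𝒳₁ 𝒳₂ 𝒴₁ 𝒴₂ n M₁ M₂)
    (W : Channel 𝒳₁ 𝒳₂ 𝒴₁ 𝒴₂ 𝒴ₑ) : ℝ :=
  1 / ((M₁ : ℝ) * M₂) * ∑ w₁ : Fin M₁, ∑ w₂ : Fin M₂,
    ∑ y : (Fin n → 𝒴₁) × (Fin n → 𝒴₂) × (Fin n → 𝒴ₑ) with c.dec₁ y.1 ≠ w₁,
      c.outputLaw W w₁ w₂ y

/-- Average error probability of receiver 2. -/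
noncomputable def SecretCode.errorProb₂ (c : SecretCode 𝒳₁ 𝒳₂ 𝒴₁ 𝒴₂ n M₁ M₂)
    (W : Channel 𝒳₁ 𝒳₂ 𝒴₁ 𝒴₂ 𝒴ₑ) : ℝ :=
  1 / ((M₁ : ℝ) * M₂) * ∑ w₁ : Fin M₁, ∑ w₂ : Fin M₂,
    ∑ y : (Fin n → 𝒴₁) × (Fin n → 𝒴₂) × (Fin n → 𝒴ₑ) with c.dec₂ y.2.1 ≠ w₂,
      c.outputLaw W w₁ w₂ y

/-- Joint law of messages and received sequences, for independent uniform messages. -/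
noncomputable def SecretCode.jointLaw (c : SecretCode 𝒳₁ 𝒳₂ 𝒴₁ 𝒴₂ n M₁ M₂)
    (W : Channel 𝒳₁ 𝒳₂ 𝒴₁ 𝒴₂ 𝒴ₑ)
    (ω : (Fin M₁ × Fin M₂) × (Fin n → 𝒴₁) × (Fin n → 𝒴₂) × (Fin n → 𝒴ₑ)) : ℝ :=
  1 / ((M₁ : ℝ) * M₂) * c.outputLaw W ω.1.1 ω.1.2 ω.2

/-- The equivocation `H(W₁, W₂ | 𝐘ₑ)` at the eavesdropper, in bits. -/
noncomputable def SecretCode.equivocation (c : SecretCode 𝒳₁ 𝒳₂ 𝒴₁ 𝒴₂ n M₁ M₂)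
    (W : Channel 𝒳₁ 𝒳₂ 𝒴₁ 𝒴₂ 𝒴ₑ) : ℝ :=
  condEntropy (c.jointLaw W) (fun ω => ω.1) (fun ω => ω.2.2.2)

/-- Achievability of a rate pair. Message sets have `⌈2 ^ (n R_k)⌉` elements. -/
def IsAchievable (W : Channel 𝒳₁ 𝒳₂ 𝒴₁ 𝒴₂ 𝒴ₑ) (R : ℝ × ℝ) : Prop :=
  0 ≤ R.1 ∧ 0 ≤ R.2 ∧ ∀ ε : ℝ, 0 < ε → ∃ N : ℕ, ∀ n : ℕ, N ≤ n →
    ∃ c : SecretCode 𝒳₁ 𝒳₂ 𝒴₁ 𝒴₂ n ⌈(2 : ℝ) ^ ((n : ℝ) * R.1)⌉₊ ⌈(2 : ℝ) ^ ((n : ℝ) * R.2)⌉₊,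
      max (c.errorProb₁ W) (c.errorProb₂ W) ≤ ε ∧
      R.1 + R.2 - 1 / (n : ℝ) * c.equivocation W ≤ ε

/-- The secrecy capacity region. -/
def secrecyCapacityRegion (W : Channel 𝒳₁ 𝒳₂ 𝒴₁ 𝒴₂ 𝒴ₑ) : Set (ℝ × ℝ) :=
  closure {R | IsAchievable W R}

end Code

/-- Labels of the auxiliary variables `T₁, …, T₆ = C₁, S₁, O₁, C₂, S₂, O₂`: the common, self and
other signals of the two transmitters. -/
inductive Aux
  | C₁ | S₁ | O₁ | C₂ | S₂ | O₂
  deriving DecidableEq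

instance : Fintype Aux where
  elems := {.C₁, .S₁, .O₁, .C₂, .S₂, .O₂}
  complete i := by cases i <;> simp

section Region

variable {𝒳₁ 𝒳₂ 𝒴₁ 𝒴₂ 𝒴ₑ : Type*} [Fintype 𝒳₁] [Fintype 𝒳₂]
  [Fintype 𝒴₁] [Fintype 𝒴₂] [Fintype 𝒴ₑ] {𝒬 : Type} [Fintype 𝒬]
  {𝒯 : Aux → Type} [∀ i, Fintype (𝒯 i)]

/-- Values of `(Q, (C₁, S₁, O₁, C₂, S₂, O₂), X₁, X₂, (Y₁, Y₂, Yₑ))`. -/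
abbrev JointAlphabet (𝒬 : Type) (𝒯 : Aux → Type) (𝒳₁ 𝒳₂ 𝒴₁ 𝒴₂ 𝒴ₑ : Type*) :=
  𝒬 × (∀ i, 𝒯 i) × 𝒳₁ × 𝒳₂ × (𝒴₁ × 𝒴₂ × 𝒴ₑ)

/-- Membership in `𝒫`: the joint law `p` factors as
`p(q) ∏ᵢ p(tᵢ|q) p(x₁|c₁,s₁,o₁,q) p(x₂|c₂,s₂,o₂,q) p(y₁,y₂,yₑ|x₁,x₂)`. -/
def IsAdmissible (W : Channel 𝒳₁ 𝒳₂ 𝒴₁ 𝒴₂ 𝒴ₑ)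
    (p : stdSimplex ℝ (JointAlphabet 𝒬 𝒯 𝒳₁ 𝒳₂ 𝒴₁ 𝒴₂ 𝒴ₑ)) : Prop :=
  ∃ (pQ : stdSimplex ℝ 𝒬) (pT : ∀ i, 𝒬 → stdSimplex ℝ (𝒯 i))
    (pX₁ : 𝒯 .C₁ → 𝒯 .S₁ → 𝒯 .O₁ → 𝒬 → stdSimplex ℝ 𝒳₁)
    (pX₂ : 𝒯 .C₂ → 𝒯 .S₂ → 𝒯 .O₂ → 𝒬 → stdSimplex ℝ 𝒳₂),
    ∀ (q : 𝒬) (t : ∀ i, 𝒯 i) (x₁ : 𝒳₁) (x₂ : 𝒳₂) (y : 𝒴₁ × 𝒴₂ × 𝒴ₑ),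
      p (q, t, x₁, x₂, y) =
        pQ q * (∏ i, pT i q (t i)) * pX₁ (t .C₁) (t .S₁) (t .O₁) q x₁ *
          pX₂ (t .C₂) (t .S₂) (t .O₂) q x₂ * W x₁ x₂ y

/-- `I(T_S; Y | T_{D \ S}, Q)` for an output `Y` that is a function of `(Y₁, Y₂, Yₑ)`. -/
noncomputable def auxInfo (p : stdSimplex ℝ (JointAlphabet 𝒬 𝒯 𝒳₁ 𝒳₂ 𝒴₁ 𝒴₂ 𝒴ₑ))
    {𝒴 : Type*} [Fintype 𝒴] (Y : 𝒴₁ × 𝒴₂ × 𝒴ₑ → 𝒴) (D S : Finset Aux) : ℝ :=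
  condMutualInfo (p : JointAlphabet 𝒬 𝒯 𝒳₁ 𝒳₂ 𝒴₁ 𝒴₂ 𝒴ₑ → ℝ)
    (fun ω => S.restrict ω.2.1) (fun ω => Y ω.2.2.2.2)
    (fun ω => ((D \ S).restrict ω.2.1, ω.1))

/-- `ℛ₁(p)`: receiver 1 decodes `C₁, S₁, C₂, O₂`. -/
def MemR₁ (p : stdSimplex ℝ (JointAlphabet 𝒬 𝒯 𝒳₁ 𝒳₂ 𝒴₁ 𝒴₂ 𝒴ₑ)) (r rx : Aux → ℝ) : Prop :=
  ∀ S ⊆ ({.C₁, .S₁, .C₂, .O₂} : Finset Aux),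
    ∑ i ∈ S, (r i + rx i) ≤ auxInfo p (fun y => y.1) {.C₁, .S₁, .C₂, .O₂} S

/-- `ℛ₂(p)`: receiver 2 decodes `C₁, O₁, C₂, S₂`. -/
def MemR₂ (p : stdSimplex ℝ (JointAlphabet 𝒬 𝒯 𝒳₁ 𝒳₂ 𝒴₁ 𝒴₂ 𝒴ₑ)) (r rx : Aux → ℝ) : Prop :=
  ∀ S ⊆ ({.C₁, .O₁, .C₂, .S₂} : Finset Aux),
    ∑ i ∈ S, (r i + rx i) ≤ auxInfo p (fun y => y.2.1) {.C₁, .O₁, .C₂, .S₂} S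

/-- `ℛₑ(p)`: conditions on the randomization rates at the eavesdropper. -/
def MemRₑ (p : stdSimplex ℝ (JointAlphabet 𝒬 𝒯 𝒳₁ 𝒳₂ 𝒴₁ 𝒴₂ 𝒴ₑ)) (rx : Aux → ℝ) : Prop :=
  (∀ S ⊂ (Finset.univ : Finset Aux),
    ∑ i ∈ S, rx i ≤ auxInfo p (fun y => y.2.2) Finset.univ S) ∧
  ∑ i, rx i = condMutualInfo (p : JointAlphabet 𝒬 𝒯 𝒳₁ 𝒳₂ 𝒴₁ 𝒴₂ 𝒴ₑ → ℝ)
    (fun ω => ω.2.1) (fun ω => ω.2.2.2.2.2.2) (fun ω => ω.1)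

/-- `ℛ(p)`. Here `r i` is the secret rate and `rx i` the randomization rate of the signal `i`; the
other signals carry no secret message. -/
def rateRegion (p : stdSimplex ℝ (JointAlphabet 𝒬 𝒯 𝒳₁ 𝒳₂ 𝒴₁ 𝒴₂ 𝒴ₑ)) : Set (ℝ × ℝ) :=
  closure {R | ∃ r rx : Aux → ℝ,
    R.1 = r .C₁ + r .S₁ ∧ R.2 = r .C₂ + r .S₂ ∧ r .O₁ = 0 ∧ r .O₂ = 0 ∧
    MemR₁ p r rx ∧ MemR₂ p r rx ∧ MemRₑ p rx ∧ (∀ i, 0 ≤ r i) ∧ (∀ i, 0 ≤ rx i)}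

/-- `⋃_{p ∈ 𝒫} ℛ(p)`, over all finite alphabets of the auxiliary variables. -/
def rateRegionUnion (W : Channel 𝒳₁ 𝒳₂ 𝒴₁ 𝒴₂ 𝒴ₑ) : Set (ℝ × ℝ) :=
  {R | ∃ (𝒬 : Type) (_ : Fintype 𝒬) (𝒯 : Aux → Type) (_ : ∀ i, Fintype (𝒯 i))
    (p : stdSimplex ℝ (JointAlphabet 𝒬 𝒯 𝒳₁ 𝒳₂ 𝒴₁ 𝒴₂ 𝒴ₑ)),
    IsAdmissible W p ∧ R ∈ rateRegion p}

end Region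

/-! The proof is random coding in which one codebook serves both receivers and confuses the
eavesdropper. Given a time sharing sequence, each of the six layers gets an independent codebook of
about `2 ^ (n (r i + rx i))` words. The message selects one part of each index and uniform private
randomness the other part. Each transmitter sends its three words through `pX₁` or `pX₂`.

Reliability: a receiver jointly tests the layers in `D` by comparing the likelihood of the output
given `D` with that given `D \ S`, for each pattern `S` of wrong layers. A change of measure shows
that a tuple wrong exactly in `S` passes with probability at most `exp (-γ S)`, so rates below
`I(T_S; Y | T_{D \ S}, Q)` suffice (`sum_codebookLaw_decodingError_le`, `sum_errorPattern_le`). Only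
patterns that meet the receiver's own message layers are tested, since the other errors do no harm.

Secrecy: subtracting the eavesdropper's condition for `Aᶜ` from the sum equality gives `∑_{i ∈ A} rx
i ≥ I(T_A; Yₑ | Q)`. This is the channel resolvability condition. Slightly above it, the output law
induced by a message has divergence from the output law of independent inputs whose mean over the
codebooks is bounded uniformly in `n` (`sum_codebookLaw_divergence_le`,
`exists_sum_log_softCovering_le`). That divergence bounds the leakage
(`le_condEntropy_of_divergence`), which therefore vanishes after division by `n`.

Slack: reliability and secrecy pull the rates in opposite directions. Every `rx i` is raised by `δ`
and every `r i` lowered by `7 * δ`, truncated at `0`. A pattern containing a layer whose message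
rate stays positive gains slack `δ`. The other patterns need no slack, because they are not tested
(`sum_perturbed_add_le`). Averaging a nonnegative combination of the three criteria yields one good
codebook (`exists_secretCode`), and `δ → 0` reaches the whole region because the capacity region is
closed. -/

open Finset

set_option linter.unusedSectionVars false

/-! ### Entropies as expectations of log-probabilities. -/

section Entropy

variable {Ω α β γ : Type*} [Fintype Ω] [Fintype α] [Fintype β] [Fintype γ]

lemma marginal_nonneg {p : Ω → ℝ} (hp : ∀ ω, 0 ≤ p ω) (f : Ω → α) (a : α) :
    0 ≤ marginal p f a := sum_nonneg fun ω _ => hp ω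

/-- Change of variables for the law of `f`. -/
lemma sum_marginal_mul (p : Ω → ℝ) (f : Ω → α) (φ : α → ℝ) :
    ∑ a, marginal p f a * φ a = ∑ ω, p ω * φ (f ω) := by
  classical
  unfold marginal
  simp_rw [sum_mul, sum_filter]
  rw [sum_comm]
  refine sum_congr rfl fun ω _ => ?_
  simp

lemma entropy_mul_log_two (p : Ω → ℝ) (f : Ω → α) :
    entropy p f * Real.log 2 = -∑ ω, p ω * Real.log (marginal p f (f ω)) := by
  have h2 : Real.log 2 ≠ 0 := (Real.log_pos one_lt_two).ne'
  rw [entropy, div_mul_cancel₀ _ h2, ← sum_marginal_mul p f (fun a => Real.log (marginal p f a)),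
    ← sum_neg_distrib]
  simp [Real.negMulLog]

/-- The factor `Real.log 2` converts bits to nats, the unit of all later estimates. -/
lemma condMutualInfo_mul_log_two (p : Ω → ℝ) (f : Ω → α) (g : Ω → β) (h : Ω → γ) :
    condMutualInfo p f g h * Real.log 2 =
      ∑ ω, p ω * (Real.log (marginal p (fun ω => (f ω, g ω, h ω)) (f ω, g ω, h ω))
        + Real.log (marginal p h (h ω)) - Real.log (marginal p (fun ω => (f ω, h ω)) (f ω, h ω))
        - Real.log (marginal p (fun ω => (g ω, h ω)) (g ω, h ω))) := by
  simp only [condMutualInfo, condEntropy, sub_mul, entropy_mul_log_two, mul_sub, mul_add,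
    sum_sub_distrib, sum_add_distrib]
  ring

end Entropy

/-! ### Independent tuples and conditioning on some of their coordinates. -/

section ProductLaw

variable {ι : Type*} [Fintype ι] [DecidableEq ι] {T : ι → Type*} [∀ i, Fintype (T i)]

/-- The law of a tuple of independent variables with laws `p i`. -/
def prodLaw (p : ∀ i, T i → ℝ) (t : ∀ i, T i) : ℝ := ∏ i, p i (t i)

lemma prodLaw_nonneg {p : ∀ i, T i → ℝ} (hp : ∀ i t, 0 ≤ p i t) (t : ∀ i, T i) :
    0 ≤ prodLaw p t := prod_nonneg fun i _ => hp i _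

lemma sum_prodLaw {p : ∀ i, T i → ℝ} (hp : ∀ i, ∑ t, p i t = 1) : ∑ t, prodLaw p t = 1 := by
  simp only [prodLaw]
  rw [← Fintype.prod_sum]
  simp [hp]

lemma prodLaw_piecewise_mul (p : ∀ i, T i → ℝ) (A : Finset ι) (t t' : ∀ i, T i) :
    prodLaw p (A.piecewise t t') * prodLaw p (A.piecewise t' t) = prodLaw p t * prodLaw p t' := by
  simp only [prodLaw, ← prod_mul_distrib]
  refine prod_congr rfl fun i _ => ?_
  by_cases h : i ∈ A <;> simp [h, mul_comm]

/-- Exchanging the coordinates outside `A` of two independent copies preserves their law. -/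
lemma sum_prodLaw_swap (p : ∀ i, T i → ℝ) (A : Finset ι) (F : (∀ i, T i) → (∀ i, T i) → ℝ) :
    ∑ t, ∑ t', prodLaw p t * prodLaw p t' * F (A.piecewise t t') (A.piecewise t' t) =
      ∑ t, ∑ t', prodLaw p t * prodLaw p t' * F t t' := by
  rw [← Fintype.sum_prod_type', ← Fintype.sum_prod_type']
  refine Fintype.sum_equiv
    (Function.Involutive.toPerm (fun x : (∀ i, T i) × (∀ i, T i) =>
      (A.piecewise x.1 x.2, A.piecewise x.2 x.1)) ?_) _ _ ?_
  · rintro ⟨t, t'⟩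
    ext i <;> by_cases h : i ∈ A <;> simp [h]
  · rintro ⟨t, t'⟩
    simp [Function.Involutive.toPerm, prodLaw_piecewise_mul]

/-- Resampling the coordinates outside `A` preserves a product law: after the swap of two copies,
the second one integrates out. -/
lemma sum_prodLaw_piecewise {p : ∀ i, T i → ℝ} (hp : ∀ i, ∑ t, p i t = 1) (A : Finset ι)
    (F : (∀ i, T i) → ℝ) :
    ∑ t, ∑ t', prodLaw p t * prodLaw p t' * F (A.piecewise t t') = ∑ t, prodLaw p t * F t := by
  rw [sum_prodLaw_swap p A (fun t _ => F t)]
  refine sum_congr rfl fun t _ => ?_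
  rw [← sum_mul, ← mul_sum, sum_prodLaw hp, mul_one]

/-- The conditional expectation of `V` given the coordinates in `A`. -/
def partialLaw (p : ∀ i, T i → ℝ) (V : (∀ i, T i) → ℝ) (A : Finset ι) (t : ∀ i, T i) : ℝ :=
  ∑ t', prodLaw p t' * V (A.piecewise t t')

lemma partialLaw_nonneg {p : ∀ i, T i → ℝ} (hp : ∀ i t, 0 ≤ p i t) {V : (∀ i, T i) → ℝ}
    (hV : ∀ t, 0 ≤ V t) (A : Finset ι) (t : ∀ i, T i) : 0 ≤ partialLaw p V A t :=
  sum_nonneg fun t' _ => mul_nonneg (prodLaw_nonneg hp t') (hV _)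

lemma partialLaw_le_one {p : ∀ i, T i → ℝ} (hp : ∀ i t, 0 ≤ p i t) (hp1 : ∀ i, ∑ t, p i t = 1)
    {V : (∀ i, T i) → ℝ} (hV : ∀ t, V t ≤ 1) (A : Finset ι) (t : ∀ i, T i) :
    partialLaw p V A t ≤ 1 := by
  rw [← sum_prodLaw hp1]
  exact sum_le_sum fun t' _ => mul_le_of_le_one_right (prodLaw_nonneg hp t') (hV _)

/-- The resampled tuple may be `t` itself, and this single term is already positive. The lemma keeps
denominators and arguments of logarithms positive on the support. -/
lemma partialLaw_pos {p : ∀ i, T i → ℝ} (hp : ∀ i t, 0 ≤ p i t) {V : (∀ i, T i) → ℝ}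
    (hV : ∀ t, 0 ≤ V t) (A : Finset ι) {t : ∀ i, T i} (ht : 0 < prodLaw p t) (hVt : 0 < V t) :
    0 < partialLaw p V A t := by
  refine lt_of_lt_of_le (mul_pos ht hVt) ?_
  have := single_le_sum (f := fun t' => prodLaw p t' * V (A.piecewise t t'))
    (fun t' _ => mul_nonneg (prodLaw_nonneg hp t') (hV _)) (mem_univ t)
  simpa only [partialLaw, A.piecewise_same t] using this

lemma partialLaw_congr (p : ∀ i, T i → ℝ) (V : (∀ i, T i) → ℝ) {A : Finset ι} {t t' : ∀ i, T i}
    (h : ∀ i ∈ A, t i = t' i) : partialLaw p V A t = partialLaw p V A t' := by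
  unfold partialLaw
  refine sum_congr rfl fun s _ => ?_
  congr 2
  ext i
  by_cases hi : i ∈ A <;> simp [hi, h]

/-- Conditioning on the coordinates in `D` does not change the mean against a weight that depends
on these coordinates only. -/
lemma sum_prodLaw_mul_partialLaw {p : ∀ i, T i → ℝ} (hp : ∀ i, ∑ t, p i t = 1) (D : Finset ι)
    {φ : (∀ i, T i) → ℝ} (hφ : ∀ t t', φ (D.piecewise t t') = φ t) (V : (∀ i, T i) → ℝ) :
    ∑ t, prodLaw p t * (φ t * partialLaw p V D t) = ∑ t, prodLaw p t * (φ t * V t) := by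
  rw [← sum_prodLaw_piecewise hp D (fun t => φ t * V t)]
  refine sum_congr rfl fun t _ => ?_
  simp only [partialLaw, mul_sum, hφ]
  exact sum_congr rfl fun t' _ => by ring

/-- The tower property. -/
lemma partialLaw_partialLaw {p : ∀ i, T i → ℝ} (hp : ∀ i, ∑ t, p i t = 1) (A D : Finset ι)
    (V : (∀ i, T i) → ℝ) (t : ∀ i, T i) :
    partialLaw p (partialLaw p V A) D t = partialLaw p V (A ∩ D) t := by
  -- Resampling outside `D` and then outside `A` leaves exactly the coordinates in `A ∩ D`
  -- untouched. By independence the rest is a fresh copy.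
  have h := sum_prodLaw_piecewise hp A (fun s => V ((A ∩ D).piecewise t s))
  rw [partialLaw, partialLaw, ← h]
  refine sum_congr rfl fun t' _ => ?_
  rw [partialLaw, mul_sum]
  refine sum_congr rfl fun t'' _ => ?_
  rw [mul_assoc]
  congr 3
  ext i
  by_cases h1 : i ∈ A <;> by_cases h2 : i ∈ D <;> simp [h1, h2]

end ProductLaw

/-! ### Random codebooks and the joint law of two of their codeword tuples. -/

section Codebook

variable {ι : Type*} [Fintype ι] [DecidableEq ι] {T : ι → Type*} [∀ i, Fintype (T i)]
  {K : ι → Type*} [∀ i, Fintype (K i)] [∀ i, DecidableEq (K i)]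

/-- The law of a random codebook: all codewords are independent, those of layer `i` have law
`p i`. -/
def codebookLaw (p : ∀ i, T i → ℝ) (B : ∀ i, K i → T i) : ℝ := ∏ i, ∏ k, p i (B i k)

/-- The tuple of codewords with index tuple `k`. -/
def codeword (B : ∀ i, K i → T i) (k : ∀ i, K i) : ∀ i, T i := fun i => B i (k i)

/-- The layers on which two index tuples agree. -/
def agree (k k' : ∀ i, K i) : Finset ι := univ.filter fun i => k i = k' i

lemma codebookLaw_nonneg {p : ∀ i, T i → ℝ} (hp : ∀ i t, 0 ≤ p i t) (B : ∀ i, K i → T i) :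
    0 ≤ codebookLaw p B := prod_nonneg fun i _ => prod_nonneg fun _ _ => hp i _

lemma sum_codebookLaw {p : ∀ i, T i → ℝ} (hp : ∀ i, ∑ t, p i t = 1) :
    ∑ B : ∀ i, K i → T i, codebookLaw p B = 1 := by
  simp only [codebookLaw]
  rw [← Fintype.prod_sum (fun i (b : K i → T i) => ∏ k, p i (b k))]
  refine prod_eq_one fun i _ => ?_
  rw [← Fintype.prod_sum (fun (_ : K i) t => p i t)]
  simp [hp]

/-- The joint law of two members of an independent family with common law `p`. -/
lemma sum_prod_mul_pair {κ τ : Type*} [Fintype κ] [DecidableEq κ] [Fintype τ] [DecidableEq τ]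
    {p : τ → ℝ} (hp : ∑ t, p t = 1) (k k' : κ) (a b : τ) :
    ∑ B : κ → τ, (∏ j, p (B j)) * ((if B k = a then 1 else 0) * (if B k' = b then 1 else 0)) =
      if k = k' then (if a = b then p a else 0) else p a * p b := by
  have h : ∀ B : κ → τ, (∏ j, p (B j)) *
      ((if B k = a then 1 else 0) * (if B k' = b then 1 else 0)) =
      ∏ j, p (B j) * ((if j = k then (if B j = a then 1 else 0) else 1) *
        (if j = k' then (if B j = b then 1 else 0) else 1)) := by
    intro B
    simp only [prod_mul_distrib, prod_ite_eq', mem_univ, if_true]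
  simp_rw [h]
  rw [← Fintype.prod_sum (fun j t => p t * ((if j = k then (if t = a then 1 else 0) else 1) *
        (if j = k' then (if t = b then 1 else 0) else 1)))]
  split_ifs with hk hab
  · subst hk hab
    rw [prod_eq_single k]
    · simp
    · intro j _ hj; simp [hj, hp]
    · simp
  · subst hk
    refine prod_eq_zero (mem_univ k) ?_
    refine sum_eq_zero fun t _ => ?_
    by_cases h1 : t = a <;> by_cases h2 : t = b <;> simp_all
  · rw [prod_eq_mul k k' hk]
    · simp [hk, Ne.symm hk]
    · rintro j _ ⟨h1, h2⟩; simp [h1, h2, hp]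
    · simp
    · simp

/-- Expectation of a function of two discrete variables in terms of their joint law. -/
lemma sum_mul_eq_sum_joint {σ α β : Type*} [Fintype σ] [Fintype α] [Fintype β] [DecidableEq α]
    [DecidableEq β] (w : σ → ℝ) (x : σ → α) (y : σ → β) (F : α → β → ℝ) :
    ∑ s, w s * F (x s) (y s) = ∑ a, ∑ b, F a b *
      ∑ s, w s * ((if x s = a then 1 else 0) * (if y s = b then 1 else 0)) := by
  simp_rw [mul_sum]
  rw [sum_congr rfl fun a _ => sum_comm, sum_comm]
  refine sum_congr rfl fun s _ => ?_
  rw [sum_eq_single (x s), sum_eq_single (y s)]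
  · simp [mul_comm]
  · intro b _ hb; simp [Ne.symm hb]
  · simp
  · intro a _ ha; simp [Ne.symm ha]
  · simp

/-- The joint law of two tuples of codewords of a random codebook. -/
lemma sum_codebookLaw_pair {p : ∀ i, T i → ℝ} (hp : ∀ i, ∑ t, p i t = 1) (k k' : ∀ i, K i)
    (F : (∀ i, T i) → (∀ i, T i) → ℝ) :
    ∑ B, codebookLaw p B * F (codeword B k) (codeword B k') =
      ∑ t, ∑ t', prodLaw p t * prodLaw p t' * F t ((agree k k').piecewise t t') := by
  classical
  -- Both sides are expectations of `F` under a law on pairs of tuples. `J` is the common mass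
  -- function: equal coordinates where the indices agree, independent ones elsewhere.
  let J : (∀ i, T i) → (∀ i, T i) → ℝ := fun a b =>
    ∏ i, if k i = k' i then (if a i = b i then p i (a i) else 0) else p i (a i) * p i (b i)
  have hl : ∀ a b, ∑ B, codebookLaw p B *
      ((if codeword B k = a then 1 else 0) * (if codeword B k' = b then 1 else 0)) = J a b := by
    intro a b
    simp only [J, ← sum_prod_mul_pair (hp _)]
    rw [Fintype.prod_sum]
    refine sum_congr rfl fun B _ => ?_
    rw [prod_mul_distrib, prod_mul_distrib, prod_ite_zero, prod_ite_zero]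
    simp [codebookLaw, codeword, funext_iff]
  have hr : ∀ a b, ∑ t, ∑ t', prodLaw p t * prodLaw p t' *
      ((if t = a then 1 else 0) * (if (agree k k').piecewise t t' = b then 1 else 0)) = J a b := by
    intro a b
    rw [sum_eq_single a]
    · simp only [if_true, one_mul, J]
      have : ∀ t', prodLaw p a * prodLaw p t' *
          (if (agree k k').piecewise a t' = b then 1 else 0) =
          ∏ i, p i (a i) * p i (t' i) *
            (if (if k i = k' i then a i else t' i) = b i then 1 else 0) := by
        intro t'
        rw [prod_mul_distrib, prod_mul_distrib, prod_ite_zero]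
        simp [prodLaw, funext_iff, Finset.piecewise, agree]
      simp_rw [this]
      rw [← Fintype.prod_sum (fun i t => p i (a i) * p i t *
            (if (if k i = k' i then a i else t) = b i then 1 else 0))]
      refine prod_congr rfl fun i _ => ?_
      split_ifs with h1 h2
      · simp [h2, ← mul_sum, hp]
      · simp
      · simp
    · intro t _ ht; simp [ht]
    · simp
  rw [sum_mul_eq_sum_joint (codebookLaw p) (fun B => codeword B k) (fun B => codeword B k') F,
    ← Fintype.sum_prod_type' (fun t t' => prodLaw p t * prodLaw p t' *
      F t ((agree k k').piecewise t t')),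
    sum_mul_eq_sum_joint (fun s : (∀ i, T i) × (∀ i, T i) => prodLaw p s.1 * prodLaw p s.2)
      (fun s => s.1) (fun s => (agree k k').piecewise s.1 s.2) F]
  refine sum_congr rfl fun a _ => sum_congr rfl fun b _ => ?_
  rw [hl, Fintype.sum_prod_type, hr]

/-- The conditional mean of a function of the codewords with index `k'`, given the codewords with
index `k`. -/
lemma sum_codebookLaw_mul {p : ∀ i, T i → ℝ} (hp : ∀ i, ∑ t, p i t = 1) (k k' : ∀ i, K i)
    (φ V : (∀ i, T i) → ℝ) :
    ∑ B, codebookLaw p B * (φ (codeword B k) * V (codeword B k')) =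
      ∑ t, prodLaw p t * (φ t * partialLaw p V (agree k k') t) := by
  rw [sum_codebookLaw_pair hp k k' (fun t t' => φ t * V t')]
  simp only [partialLaw, mul_sum]
  exact sum_congr rfl fun t _ => sum_congr rfl fun t' _ => by ring

lemma sum_codebookLaw_codeword {p : ∀ i, T i → ℝ} (hp : ∀ i, ∑ t, p i t = 1) (k : ∀ i, K i)
    (φ : (∀ i, T i) → ℝ) :
    ∑ B, codebookLaw p B * φ (codeword B k) = ∑ t, prodLaw p t * φ t := by
  have h := sum_codebookLaw_mul hp k k φ (fun _ => 1)
  simpa [partialLaw, sum_prodLaw hp] using h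

lemma prodLaw_codeword_pos {p : ∀ i, T i → ℝ} (hp : ∀ i t, 0 ≤ p i t) {B : ∀ i, K i → T i}
    (hB : 0 < codebookLaw p B) (k : ∀ i, K i) : 0 < prodLaw p (codeword B k) := by
  refine (prodLaw_nonneg hp _).lt_of_ne' fun h => hB.ne' ?_
  obtain ⟨i, -, hi⟩ := prod_eq_zero_iff.1 h
  exact prod_eq_zero (mem_univ i) (prod_eq_zero (mem_univ (k i)) hi)

end Codebook

/-! ### One-shot bounds: joint threshold decoding and soft covering. -/

section OneShot

variable {ι : Type*} [Fintype ι] [DecidableEq ι] {T : ι → Type*} [∀ i, Fintype (T i)]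
  {K : ι → Type*} [∀ i, Fintype (K i)] [∀ i, DecidableEq (K i)] {Y : Type*} [Fintype Y]

/-- A weight that sees only the coordinates in `D` allows further conditioning on `D`, and the tower
property leaves `A ∩ D`. -/
lemma sum_prodLaw_mul_partialLaw_inter {p : ∀ i, T i → ℝ} (hp : ∀ i, ∑ t, p i t = 1)
    (A D : Finset ι) {φ : (∀ i, T i) → ℝ} (hφ : ∀ t t', φ (D.piecewise t t') = φ t)
    (V : (∀ i, T i) → ℝ) :
    ∑ t, prodLaw p t * (φ t * partialLaw p V A t) =
      ∑ t, prodLaw p t * (φ t * partialLaw p V (A ∩ D) t) := by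
  rw [← sum_prodLaw_mul_partialLaw hp D hφ (partialLaw p V A)]
  simp_rw [partialLaw_partialLaw hp]

lemma sum_prodLaw_partialLaw {p : ∀ i, T i → ℝ} (hp : ∀ i, ∑ t, p i t = 1)
    (A : Finset ι) (V : (∀ i, T i) → ℝ) :
    ∑ t, prodLaw p t * partialLaw p V A t = ∑ t, prodLaw p t * V t := by
  simpa using sum_prodLaw_mul_partialLaw hp A (φ := fun _ => 1) (fun _ _ => rfl) V

lemma partialLaw_empty (p : ∀ i, T i → ℝ) (V : (∀ i, T i) → ℝ) (t : ∀ i, T i) :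
    partialLaw p V ∅ t = ∑ t', prodLaw p t' * V t' := by
  simp [partialLaw]

lemma agree_comm (k k' : ∀ i, K i) : agree k k' = agree k' k := by
  ext i; simp [agree, eq_comm]

/-- Outside `S` the tuple `k'` is forced to equal `k`. Inside `S` it must differ from `k`, a
restriction that the bound ignores. -/
lemma card_filter_compl_agree_le (k : ∀ i, K i) (S : Finset ι) :
    (univ.filter fun k' : ∀ i, K i => (agree k k')ᶜ = S).card ≤
      ∏ i ∈ S, Fintype.card (K i) := by
  have h : (univ.filter fun k' : ∀ i, K i => (agree k k')ᶜ = S) ⊆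
      Fintype.piFinset fun i => if i ∈ S then univ else {k i} := by
    intro k' hk'
    simp only [mem_filter, mem_univ, true_and] at hk'
    rw [Fintype.mem_piFinset]
    intro i
    split_ifs with hi
    · exact mem_univ _
    · rw [← hk'] at hi
      simp only [agree, mem_compl, mem_filter, mem_univ, true_and, not_not] at hi
      simp [hi]
  refine (card_le_card h).trans (le_of_eq ?_)
  rw [Fintype.card_piFinset, ← prod_filter_mul_prod_filter_not univ (· ∈ S)]
  rw [prod_congr rfl (g := fun i => Fintype.card (K i)), prod_eq_one (s := filter (· ∉ S) univ),
    mul_one]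
  · simp
  · intro i hi; simp at hi; simp [hi]
  · intro i hi; simp at hi; simp [hi]

/-- The threshold test of a joint decoder for the layers in `D` on the codewords `t` and the
output `y`. Only error patterns that meet `E` are tested. -/
def DecodingTest (p : ∀ i, T i → ℝ) (V : (∀ i, T i) → Y → ℝ) (D E : Finset ι)
    (γ : Finset ι → ℝ) (t : ∀ i, T i) (y : Y) : Prop :=
  ∀ S ⊆ D, (S ∩ E).Nonempty →
    Real.exp (γ S) * partialLaw p (V · y) (D \ S) t ≤ partialLaw p (V · y) D t

/-- The transmitted index tuple `k` fails the test, or an index tuple that differs from it in a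
layer in `E` passes the test. -/
def DecodingError (p : ∀ i, T i → ℝ) (V : (∀ i, T i) → Y → ℝ) (D E : Finset ι)
    (γ : Finset ι → ℝ) (B : ∀ i, K i → T i) (k : ∀ i, K i) (y : Y) : Prop :=
  ¬ DecodingTest p V D E γ (codeword B k) y ∨
    ∃ k', (∃ i ∈ E, k' i ≠ k i) ∧ DecodingTest p V D E γ (codeword B k') y

lemma decodingTest_congr (p : ∀ i, T i → ℝ) (V : (∀ i, T i) → Y → ℝ) (D E : Finset ι)
    (γ : Finset ι → ℝ) {t t' : ∀ i, T i} (h : ∀ i ∈ D, t i = t' i) (y : Y) :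
    DecodingTest p V D E γ t y ↔ DecodingTest p V D E γ t' y := by
  unfold DecodingTest
  refine forall_congr' fun S => forall_congr' fun _ => forall_congr' fun _ => ?_
  rw [partialLaw_congr p _ h, partialLaw_congr p (A := D \ S) _ fun i hi => h i (mem_sdiff.1 hi).1]

open scoped Classical in
/-- A wrong index tuple passes the test with small probability. -/
lemma sum_codebookLaw_wrong_le {p : ∀ i, T i → ℝ} (hp0 : ∀ i t, 0 ≤ p i t)
    (hp : ∀ i, ∑ t, p i t = 1) {V : (∀ i, T i) → Y → ℝ} (hV0 : ∀ t y, 0 ≤ V t y)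
    (hV : ∀ t, ∑ y, V t y = 1) (D E : Finset ι) (γ : Finset ι → ℝ) (k k' : ∀ i, K i) (hD : (agree k k')ᶜ ⊆ D)
    (hE : ((agree k k')ᶜ ∩ E).Nonempty) :
    ∑ B, codebookLaw p B * ∑ y, V (codeword B k) y *
      (if DecodingTest p V D E γ (codeword B k') y then 1 else 0) ≤
      Real.exp (-γ (agree k k')ᶜ) := by
  have key : ∀ y, ∑ B, codebookLaw p B * (V (codeword B k) y *
      (if DecodingTest p V D E γ (codeword B k') y then 1 else 0)) ≤
      Real.exp (-γ (agree k k')ᶜ) * ∑ t, prodLaw p t * V t y := by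
    intro y
    set φ : (∀ i, T i) → ℝ := fun t => if DecodingTest p V D E γ t y then 1 else 0 with hφ
    have hφD : ∀ t t', φ (D.piecewise t t') = φ t := by
      intro t t'
      simp only [hφ]
      rw [decodingTest_congr p V D E γ (t := D.piecewise t t') (t' := t)]
      intro i hi; simp [hi]
    -- Here the tested codewords `k'` are held fixed and the transmitted ones `k` are averaged, so
    -- the output has the conditional law given only the layers shared by both tuples.
    have h1 := sum_codebookLaw_mul hp k' k φ (V · y)
    simp_rw [mul_comm (φ _) (V _ y)] at h1
    rw [h1, sum_prodLaw_mul_partialLaw_inter hp _ D hφD, ← sum_prodLaw_partialLaw hp D (V · y),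
      mul_sum]
    refine sum_le_sum fun t _ => ?_
    rw [mul_left_comm (Real.exp _)]
    refine mul_le_mul_of_nonneg_left ?_ (prodLaw_nonneg hp0 t)
    have hDS : agree k' k ∩ D = D \ (agree k k')ᶜ := by
      rw [agree_comm]; ext i; simp [and_comm]
    rw [hDS]
    simp only [hφ]
    split_ifs with ht
    -- Passing the test for this very pattern is the change of measure: it replaces the law given `D
    -- \ S` by `exp (-γ S)` times the law given `D`, which sums to at most one.
    · have := ht _ hD hE
      rw [one_mul, Real.exp_neg, inv_mul_eq_div, le_div_iff₀ (Real.exp_pos _), mul_comm]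
      exact this
    · rw [zero_mul]
      exact mul_nonneg (Real.exp_pos _).le (partialLaw_nonneg hp0 (fun t => hV0 t y) D t)
  simp_rw [mul_sum]
  rw [sum_comm]
  refine (sum_le_sum fun y _ => key y).trans (le_of_eq ?_)
  rw [← mul_sum, sum_comm]
  simp_rw [← mul_sum, hV, mul_one, sum_prodLaw hp, mul_one]

open scoped Classical in
/-- The random coding bound for joint decoding of the layers in `D` when only the layers in `E`
have to be recovered. -/
theorem sum_codebookLaw_decodingError_le {p : ∀ i, T i → ℝ} (hp0 : ∀ i t, 0 ≤ p i t)
    (hp : ∀ i, ∑ t, p i t = 1) {V : (∀ i, T i) → Y → ℝ} (hV0 : ∀ t y, 0 ≤ V t y)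
    (hV : ∀ t, ∑ y, V t y = 1) {D E : Finset ι} (hED : E ⊆ D) (γ : Finset ι → ℝ)
    (k : ∀ i, K i) :
    ∑ B, codebookLaw p B * ∑ y, V (codeword B k) y *
      (if DecodingError p V D E γ B k y then 1 else 0) ≤
    ∑ t, prodLaw p t * ∑ y, V t y * (if DecodingTest p V D E γ t y then 0 else 1) +
      ∑ S ∈ D.powerset with (S ∩ E).Nonempty,
        (∏ i ∈ S, (Fintype.card (K i) : ℝ)) * Real.exp (-γ S) := by
  set W : Finset (∀ i, K i) := univ.filter fun k' =>
    (agree k k')ᶜ ∈ D.powerset.filter fun S => (S ∩ E).Nonempty with hW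
  have hpt : ∀ (B : ∀ i, K i → T i) y, (if DecodingError p V D E γ B k y then (1 : ℝ) else 0) ≤
      (if DecodingTest p V D E γ (codeword B k) y then 0 else 1) +
        ∑ k' ∈ W, (if DecodingTest p V D E γ (codeword B k') y then 1 else 0) := by
    intro B y
    have hs : (0 : ℝ) ≤ ∑ k' ∈ W, (if DecodingTest p V D E γ (codeword B k') y then 1 else 0) :=
      sum_nonneg fun _ _ => by split_ifs <;> norm_num
    split_ifs with h1 h2
    · rcases h1 with h1 | ⟨k', ⟨i, hi, hik⟩, h1⟩
      · exact absurd h2 h1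
      · rw [zero_add]
        -- The test ignores the layers outside `D`, so the wrong tuple may be corrected there. The
        -- union bound then runs only over patterns inside `D`.
        let k'' : ∀ i, K i := D.piecewise k' k
        have hmem : k'' ∈ W := by
          simp only [hW, mem_filter, mem_univ, true_and, mem_powerset]
          refine ⟨fun j hj => ?_, i, ?_⟩
          · by_contra hjD
            simp [agree, k'', hjD] at hj
          · simp [agree, k'', hi, hED hi, Ne.symm hik]
        have hpass : DecodingTest p V D E γ (codeword B k'') y := by
          rw [decodingTest_congr p V D E γ (t' := codeword B k')]
          · exact h1
          · intro j hj; simp [codeword, k'', hj]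
        have := single_le_sum (f := fun k' =>
          if DecodingTest p V D E γ (codeword B k') y then (1 : ℝ) else 0)
          (fun _ _ => by split_ifs <;> norm_num) hmem
        simpa [hpass] using this
    · linarith
    · linarith
    · linarith
  have hsplit : ∑ B, codebookLaw p B * ∑ y, V (codeword B k) y *
      (if DecodingError p V D E γ B k y then 1 else 0) ≤
      ∑ B, codebookLaw p B * (∑ y, V (codeword B k) y *
        (if DecodingTest p V D E γ (codeword B k) y then 0 else 1)) +
      ∑ k' ∈ W, ∑ B, codebookLaw p B * ∑ y, V (codeword B k) y *
      (if DecodingTest p V D E γ (codeword B k') y then 1 else 0) := by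
    rw [sum_comm (s := W), ← sum_add_distrib]
    refine sum_le_sum fun B _ => ?_
    rw [← mul_sum, ← mul_add, sum_comm, ← sum_add_distrib]
    refine mul_le_mul_of_nonneg_left (sum_le_sum fun y _ => ?_) (codebookLaw_nonneg hp0 B)
    rw [← mul_sum, ← mul_add]
    exact mul_le_mul_of_nonneg_left (hpt B y) (hV0 _ _)
  refine hsplit.trans (add_le_add (le_of_eq ?_) ?_)
  · exact sum_codebookLaw_codeword hp k (fun t => ∑ y, V t y *
        (if DecodingTest p V D E γ t y then 0 else 1))
  · have h1 : ∀ k' ∈ W, ∑ B, codebookLaw p B * ∑ y, V (codeword B k) y *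
        (if DecodingTest p V D E γ (codeword B k') y then 1 else 0) ≤
        Real.exp (-γ (agree k k')ᶜ) := by
      intro k' hk'
      simp only [hW, mem_filter, mem_univ, true_and, mem_powerset] at hk'
      exact sum_codebookLaw_wrong_le hp0 hp hV0 hV D E γ k k' hk'.1 hk'.2
    refine (sum_le_sum h1).trans ?_
    -- The wrong tuples are grouped by the set of layers in which they differ from `k`.
    rw [← sum_fiberwise_of_maps_to (s := W) (g := fun k' => (agree k k')ᶜ)
      (t := D.powerset.filter fun S => (S ∩ E).Nonempty)
      (fun k' hk' => by rw [hW] at hk'; exact (mem_filter.1 hk').2)]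
    refine sum_le_sum fun S _ => ?_
    rw [sum_congr rfl (g := fun _ => Real.exp (-γ S))
      (fun k' hk' => by rw [(mem_filter.1 hk').2]), sum_const, nsmul_eq_mul]
    refine mul_le_mul_of_nonneg_right ?_ (Real.exp_pos _).le
    have := (card_le_card (filter_subset_filter _ (subset_univ W))).trans
      (card_filter_compl_agree_le k S)
    exact_mod_cast this

section Resolvability

variable {α β : ι → Type*} [∀ i, Fintype (α i)] [∀ i, Fintype (β i)] [∀ i, DecidableEq (α i)]
  [∀ i, DecidableEq (β i)]

/-- The output law when the message parts `a` of the indices are fixed and their randomization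
parts are uniform. -/
noncomputable def inducedLaw (V : (∀ i, T i) → Y → ℝ) (B : ∀ i, α i × β i → T i) (a : ∀ i, α i)
    (y : Y) : ℝ :=
  (∏ i, (Fintype.card (β i) : ℝ))⁻¹ * ∑ b : ∀ i, β i, V (codeword B fun i => (a i, b i)) y

/-- A bound for the conditional mean of the likelihood ratio between `inducedLaw` and the output
law, given the transmitted codewords. -/
noncomputable def softCovering (p : ∀ i, T i → ℝ) (V : (∀ i, T i) → Y → ℝ) (N : ι → ℝ)
    (t : ∀ i, T i) (y : Y) : ℝ :=
  ∑ A : Finset ι, (∏ i ∈ A, N i)⁻¹ * (partialLaw p (V · y) A t / partialLaw p (V · y) ∅ t)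

/-- At most `∏ i ∈ Aᶜ, card (β i)` tuples agree with `b` exactly on `A`; dividing by the full
product leaves the inverse product over `A`. -/
lemma sum_partialLaw_agree_le {p : ∀ i, T i → ℝ} (hp0 : ∀ i t, 0 ≤ p i t)
    {V : (∀ i, T i) → ℝ} (hV0 : ∀ t, 0 ≤ V t) [∀ i, Nonempty (β i)] (b : ∀ i, β i)
    (t : ∀ i, T i) :
    (∏ i, (Fintype.card (β i) : ℝ))⁻¹ * ∑ b' : ∀ i, β i, partialLaw p V (agree b b') t ≤
      ∑ A : Finset ι, (∏ i ∈ A, (Fintype.card (β i) : ℝ))⁻¹ * partialLaw p V A t := by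
  have hc : ∀ A : Finset ι, (0 : ℝ) < ∏ i ∈ A, (Fintype.card (β i) : ℝ) := fun A =>
    prod_pos fun i _ => Nat.cast_pos.2 Fintype.card_pos
  rw [← sum_fiberwise (s := univ) (g := fun b' => agree b b'), mul_sum]
  refine sum_le_sum fun A _ => ?_
  rw [sum_congr rfl (g := fun _ => partialLaw p V A t)
      (fun k' hk' => by rw [(mem_filter.1 hk').2]), sum_const, nsmul_eq_mul, ← mul_assoc]
  refine mul_le_mul_of_nonneg_right ?_ (partialLaw_nonneg hp0 hV0 A t)
  rw [inv_mul_le_iff₀ (hc _), ← prod_mul_prod_compl A, mul_comm, inv_mul_cancel_left₀ (hc A).ne']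
  have := card_filter_compl_agree_le b Aᶜ
  simp only [compl_inj_iff] at this
  exact_mod_cast this

lemma agree_mk (a : ∀ i, α i) (b b' : ∀ i, β i) :
    agree (fun i => (a i, b i)) (fun i => (a i, b' i)) = agree b b' := by
  ext i; simp [agree]

/-- This is Jensen's inequality for the logarithm, conditionally on the transmitted codewords. It is
used through the tangent bound `log x ≤ log m + x / m - 1` with `m` the value of `softCovering`, so
it suffices that the conditional mean of the likelihood ratio `x` is at most `m`. -/
lemma sum_codebookLaw_log_le {p : ∀ i, T i → ℝ} (hp0 : ∀ i t, 0 ≤ p i t)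
    (hp : ∀ i, ∑ t, p i t = 1) {V : (∀ i, T i) → Y → ℝ} (hV0 : ∀ t y, 0 ≤ V t y)
    [∀ i, Nonempty (β i)] (a : ∀ i, α i) (b : ∀ i, β i) (y : Y) :
    ∑ B, codebookLaw p B * (V (codeword B fun i => (a i, b i)) y *
      Real.log (inducedLaw V B a y / ∑ t, prodLaw p t * V t y)) ≤
    ∑ t, prodLaw p t * (V t y *
      Real.log (softCovering p V (fun i => Fintype.card (β i)) t y)) := by
  set N : ι → ℝ := fun i => Fintype.card (β i) with hN
  have hc : ∀ A : Finset ι, (0 : ℝ) < ∏ i ∈ A, N i := fun A =>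
    prod_pos fun i _ => Nat.cast_pos.2 Fintype.card_pos
  set Q : ℝ := ∑ t, prodLaw p t * V t y with hQ
  have hQ0 : 0 ≤ Q := sum_nonneg fun t _ => mul_nonneg (prodLaw_nonneg hp0 t) (hV0 t y)
  set m : (∀ i, T i) → ℝ := fun t => softCovering p V N t y with hm
  have hQe : ∀ t, partialLaw p (V · y) ∅ t = Q := fun t => partialLaw_empty p _ t
  have hmQ : ∀ t, m t = (∑ A : Finset ι, (∏ i ∈ A, N i)⁻¹ * partialLaw p (V · y) A t) / Q := by
    intro t
    simp only [hm, softCovering, hQe, sum_div, mul_div_assoc]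
  have hm0 : ∀ t, 0 ≤ m t := by
    intro t
    rw [hmQ]
    exact div_nonneg (sum_nonneg fun A _ => mul_nonneg (inv_nonneg.2 (hc A).le)
      (partialLaw_nonneg hp0 (hV0 · y) A t)) hQ0
  have hmpos : ∀ t, 0 < prodLaw p t → 0 < V t y → 0 < Q ∧ 0 < m t := by
    intro t ht hVt
    have hQp : 0 < Q := by
      rw [← hQe t]; exact partialLaw_pos hp0 (hV0 · y) _ ht hVt
    refine ⟨hQp, ?_⟩
    rw [hmQ]
    refine div_pos (sum_pos (fun A _ => mul_pos (inv_pos.2 (hc A)) ?_) univ_nonempty) hQp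
    exact partialLaw_pos hp0 (hV0 · y) _ ht hVt
  set k : ∀ i, α i × β i := fun i => (a i, b i) with hk
  -- `φ` collects the factors of the tangent term `x / m` that depend on the transmitted codewords
  -- only, so that the term is linear in the induced law.
  set φ : (∀ i, T i) → ℝ := fun t => V t y / (Q * m t) with hφ
  have hφ0 : ∀ t, 0 ≤ φ t := fun t => div_nonneg (hV0 t y) (mul_nonneg hQ0 (hm0 t))
  have hpt : ∀ B : ∀ i, α i × β i → T i, codebookLaw p B * (V (codeword B k) y *
      Real.log (inducedLaw V B a y / Q)) ≤
      codebookLaw p B * (V (codeword B k) y * Real.log (m (codeword B k))) +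
      (codebookLaw p B * (φ (codeword B k) * inducedLaw V B a y) -
        codebookLaw p B * V (codeword B k) y) := by
    intro B
    rcases (codebookLaw_nonneg hp0 B).eq_or_lt with h0 | h0
    · simp [← h0]
    rcases (hV0 (codeword B k) y).eq_or_lt with h1 | h1
    · simp [← h1, hφ]
    obtain ⟨hQp, hmp⟩ := hmpos _ (prodLaw_codeword_pos hp0 h0 k) h1
    have hind : 0 < inducedLaw V B a y := by
      refine mul_pos (inv_pos.2 (hc univ)) (sum_pos' (fun b _ => hV0 _ _) ⟨b, mem_univ b, h1⟩)
    have hlog := Real.log_le_sub_one_of_pos (div_pos (div_pos hind hQp) hmp)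
    rw [Real.log_div (div_pos hind hQp).ne' hmp.ne'] at hlog
    have hz : Real.log (inducedLaw V B a y / Q) ≤ Real.log (m (codeword B k)) +
        (inducedLaw V B a y / Q / m (codeword B k) - 1) := by linarith
    calc _ ≤ codebookLaw p B * (V (codeword B k) y * (Real.log (m (codeword B k)) +
        (inducedLaw V B a y / Q / m (codeword B k) - 1))) := by gcongr
      _ = _ := by simp only [hφ]; field_simp
  -- The linear terms of the tangent bound cancel in the mean: given the transmitted words, a
  -- competing tuple `b'` contributes the output law conditioned on the layers where it agrees with
  -- `b`.
  have hind : ∑ B, codebookLaw p B * (φ (codeword B k) * inducedLaw V B a y) ≤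
      ∑ B, codebookLaw p B * V (codeword B k) y := by
    rw [sum_codebookLaw_codeword hp k (V · y)]
    have : ∀ B : ∀ i, α i × β i → T i,
        codebookLaw p B * (φ (codeword B k) * inducedLaw V B a y) =
        (∏ i, N i)⁻¹ * ∑ b' : ∀ i, β i, codebookLaw p B * (φ (codeword B k) *
          V (codeword B fun i => (a i, b' i)) y) := by
      intro B
      simp only [inducedLaw, mul_sum, hN]
      exact sum_congr rfl fun _ _ => by ring
    simp_rw [this]
    rw [← mul_sum, sum_comm]
    simp_rw [sum_codebookLaw_mul (K := fun i => α i × β i) hp k _ φ (V · y), hk, agree_mk]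
    rw [sum_comm, mul_sum]
    refine sum_le_sum fun t _ => ?_
    rw [← mul_sum, ← mul_sum, mul_left_comm, mul_left_comm _ (φ t)]
    rcases (prodLaw_nonneg hp0 t).eq_or_lt with h0 | h0
    · simp [← h0]
    rcases (hV0 t y).eq_or_lt with h1 | h1
    · simp [← h1, hφ]
    obtain ⟨hQp, hmp⟩ := hmpos _ h0 h1
    refine mul_le_mul_of_nonneg_left ?_ h0.le
    have h2 := sum_partialLaw_agree_le hp0 (hV0 · y) b t
    have h3 : (∑ A : Finset ι, (∏ i ∈ A, N i)⁻¹ * partialLaw p (V · y) A t) = Q * m t := by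
      rw [hmQ]; field_simp
    rw [← hN] at h2
    calc _ ≤ φ t * (Q * m t) := by
            rw [← h3]; exact mul_le_mul_of_nonneg_left h2 (hφ0 t)
      _ = V t y := by simp only [hφ]; field_simp
  refine (sum_le_sum fun B _ => hpt B).trans ?_
  rw [sum_add_distrib, sum_sub_distrib,
    sum_codebookLaw_codeword hp k (fun t => V t y * Real.log (m t))]
  linarith

/-- The mean divergence between the output law induced by a random codebook and the output law of
independent inputs. -/
theorem sum_codebookLaw_divergence_le {p : ∀ i, T i → ℝ} (hp0 : ∀ i t, 0 ≤ p i t)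
    (hp : ∀ i, ∑ t, p i t = 1) {V : (∀ i, T i) → Y → ℝ} (hV0 : ∀ t y, 0 ≤ V t y)
    [∀ i, Nonempty (β i)] (a : ∀ i, α i) :
    ∑ B : ∀ i, α i × β i → T i, codebookLaw p B * ∑ y, inducedLaw V B a y *
      Real.log (inducedLaw V B a y / ∑ t, prodLaw p t * V t y) ≤
    ∑ t, prodLaw p t * ∑ y, V t y *
      Real.log (softCovering p V (fun i => Fintype.card (β i)) t y) := by
  have hc : (0 : ℝ) < ∏ i, (Fintype.card (β i) : ℝ) :=
    prod_pos fun i _ => Nat.cast_pos.2 Fintype.card_pos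
  simp_rw [mul_sum]
  rw [sum_comm, sum_comm (s := (univ : Finset (∀ i, T i)))]
  refine sum_le_sum fun y _ => ?_
  have h : ∀ B : ∀ i, α i × β i → T i, codebookLaw p B * (inducedLaw V B a y *
      Real.log (inducedLaw V B a y / ∑ t, prodLaw p t * V t y)) =
      (∏ i, (Fintype.card (β i) : ℝ))⁻¹ * ∑ b : ∀ i, β i, codebookLaw p B *
        (V (codeword B fun i => (a i, b i)) y *
          Real.log (inducedLaw V B a y / ∑ t, prodLaw p t * V t y)) := by
    intro B
    conv_lhs => rw [inducedLaw]
    rw [← mul_sum, ← sum_mul]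
    simp only [inducedLaw]
    ring
  simp_rw [h]
  rw [← mul_sum, sum_comm, inv_mul_le_iff₀ hc]
  refine (sum_le_sum fun b _ => sum_codebookLaw_log_le hp0 hp hV0 a b y).trans ?_
  rw [sum_const, nsmul_eq_mul, card_univ, Fintype.card_pi]
  push_cast
  exact le_rfl

end Resolvability

end OneShot

/-! ### A weak law of large numbers with rate `1 / n`. -/

section Chebyshev

variable {Ω : Type*} [Fintype Ω]

lemma sum_prod_law {P : Ω → ℝ} (hP : ∑ ω, P ω = 1) (n : ℕ) :
    ∑ ω : Fin n → Ω, ∏ j, P (ω j) = 1 := by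
  rw [← Fintype.prod_sum (fun (_ : Fin n) ω => P ω)]
  simp [hP]

lemma sum_fin_succ (n : ℕ) (F : (Fin (n + 1) → Ω) → ℝ) :
    ∑ ω, F ω = ∑ x : Ω, ∑ ω : Fin n → Ω, F (Fin.cons x ω) := by
  rw [← Fintype.sum_prod_type', ← (Fin.consEquiv (fun _ : Fin (n + 1) => Ω)).sum_comp]
  rfl

/-- The variance of a sum of independent centred variables. -/
lemma sum_prod_mul_sq {P : Ω → ℝ} (hP : ∑ ω, P ω = 1) {g : Ω → ℝ} (hg : ∑ ω, P ω * g ω = 0)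
    (n : ℕ) :
    ∑ ω : Fin n → Ω, (∏ j, P (ω j)) * (∑ j, g (ω j)) ^ 2 = n * ∑ ω, P ω * g ω ^ 2 := by
  induction n with
  | zero => simp
  | succ n ih =>
    rw [sum_fin_succ]
    simp only [Fin.prod_univ_succ, Fin.sum_univ_succ, Fin.cons_zero, Fin.cons_succ]
    have h : ∀ (x : Ω) (ω : Fin n → Ω), P x * (∏ j, P (ω j)) * (g x + ∑ j, g (ω j)) ^ 2 =
        (P x * g x ^ 2) * (∏ j, P (ω j)) +
        (P x * g x) * (2 * ((∏ j, P (ω j)) * ∑ j, g (ω j))) +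
        P x * ((∏ j, P (ω j)) * (∑ j, g (ω j)) ^ 2) := fun x ω => by ring
    simp only [h, sum_add_distrib, ← mul_sum, ← sum_mul, hP, hg, ih, sum_prod_law hP]
    push_cast
    ring

open scoped Classical in
/-- Chebyshev's inequality for the mean of independent identically distributed variables. -/
lemma sum_prod_deviation_le {P : Ω → ℝ} (hP0 : ∀ ω, 0 ≤ P ω) (hP : ∑ ω, P ω = 1) (f : Ω → ℝ)
    {η : ℝ} (hη : 0 < η) {n : ℕ} (hn : 0 < n) :
    ∑ ω : Fin n → Ω, (∏ j, P (ω j)) *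
      (if n * η ≤ |∑ j, f (ω j) - n * ∑ x, P x * f x| then 1 else 0) ≤
      (∑ x, P x * (f x - ∑ x', P x' * f x') ^ 2) / η ^ 2 / n := by
  have hn' : (0 : ℝ) < n := Nat.cast_pos.2 hn
  set μ := ∑ x, P x * f x with hμ
  have hg : ∑ x, P x * (f x - μ) = 0 := by
    simp only [mul_sub, sum_sub_distrib, ← sum_mul, hP]
    rw [← hμ]; ring
  have h := sum_prod_mul_sq hP hg n
  rw [div_div, le_div_iff₀ (by positivity), sum_mul]
  refine le_of_mul_le_mul_left ?_ hn'
  rw [← h, mul_sum]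
  refine sum_le_sum fun ω _ => ?_
  have hp : 0 ≤ ∏ j, P (ω j) := prod_nonneg fun j _ => hP0 _
  have hs : ∑ j, (f (ω j) - μ) = ∑ j, f (ω j) - n * μ := by simp [sum_sub_distrib]
  rw [hs]
  split_ifs with hd
  · have : (n * η) ^ 2 ≤ (∑ j, f (ω j) - n * μ) ^ 2 := by
      rw [← sq_abs (∑ j, f (ω j) - n * μ)]
      gcongr
    calc _ = (∏ j, P (ω j)) * (n * η) ^ 2 := by ring
      _ ≤ _ := by gcongr
  · simp only [mul_zero, zero_mul]; positivity

end Chebyshev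

/-! ### Memoryless blocks: typicality and the two one-shot bounds at length `n`. -/

section Block

variable {ι : Type*} [Fintype ι] [DecidableEq ι] {𝒬 : Type*} [Fintype 𝒬] {𝒯 : ι → Type*}
  [∀ i, Fintype (𝒯 i)] {𝒴 : Type*} [Fintype 𝒴] {n : ℕ}

/-- The law of the codewords of layer `i` given the time sharing sequence `q`. -/
def blockLaw (pT : ∀ i, 𝒬 → stdSimplex ℝ (𝒯 i)) (q : Fin n → 𝒬) (i : ι) (t : Fin n → 𝒯 i) : ℝ :=
  ∏ j, pT i (q j) (t j)

/-- The memoryless extension of the channel `V`. -/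
def blockChannel (V : 𝒬 → (∀ i, 𝒯 i) → stdSimplex ℝ 𝒴) (q : Fin n → 𝒬)
    (t : ∀ i, Fin n → 𝒯 i) (y : Fin n → 𝒴) : ℝ :=
  ∏ j, V (q j) (fun i => t i j) (y j)

/-- The joint law of the time sharing variable, the layers and the output. -/
def letterLaw (pQ : stdSimplex ℝ 𝒬) (pT : ∀ i, 𝒬 → stdSimplex ℝ (𝒯 i))
    (V : 𝒬 → (∀ i, 𝒯 i) → stdSimplex ℝ 𝒴) (ω : 𝒬 × (∀ i, 𝒯 i) × 𝒴) : ℝ :=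
  pQ ω.1 * prodLaw (fun i => pT i ω.1) ω.2.1 * V ω.1 ω.2.1 ω.2.2

/-- The conditional law of the output given the layers in `A` and the time sharing variable. -/
def letterCond (pT : ∀ i, 𝒬 → stdSimplex ℝ (𝒯 i)) (V : 𝒬 → (∀ i, 𝒯 i) → stdSimplex ℝ 𝒴)
    (A : Finset ι) (ω : 𝒬 × (∀ i, 𝒯 i) × 𝒴) : ℝ :=
  partialLaw (fun i => pT i ω.1) (fun t => V ω.1 t ω.2.2) A ω.2.1

/-- Minus the conditional entropy, in nats, of the output given the layers in `A` and the time
sharing variable. -/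
noncomputable def logLikelihood (pQ : stdSimplex ℝ 𝒬) (pT : ∀ i, 𝒬 → stdSimplex ℝ (𝒯 i))
    (V : 𝒬 → (∀ i, 𝒯 i) → stdSimplex ℝ 𝒴) (A : Finset ι) : ℝ :=
  ∑ ω, letterLaw pQ pT V ω * Real.log (letterCond pT V A ω)

variable (pQ : stdSimplex ℝ 𝒬) (pT : ∀ i, 𝒬 → stdSimplex ℝ (𝒯 i))
  (V : 𝒬 → (∀ i, 𝒯 i) → stdSimplex ℝ 𝒴)

lemma blockLaw_nonneg (q : Fin n → 𝒬) (i : ι) (t : Fin n → 𝒯 i) : 0 ≤ blockLaw pT q i t :=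
  prod_nonneg fun _ _ => stdSimplex.zero_le _ _

lemma sum_blockLaw (q : Fin n → 𝒬) (i : ι) : ∑ t, blockLaw pT q i t = 1 := by
  simp only [blockLaw]
  rw [← Fintype.prod_sum (fun j t => pT i (q j) t)]
  simp

lemma blockChannel_nonneg (q : Fin n → 𝒬) (t : ∀ i, Fin n → 𝒯 i) (y : Fin n → 𝒴) :
    0 ≤ blockChannel V q t y :=
  prod_nonneg fun _ _ => stdSimplex.zero_le _ _

lemma sum_blockChannel (q : Fin n → 𝒬) (t : ∀ i, Fin n → 𝒯 i) :
    ∑ y, blockChannel V q t y = 1 := by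
  simp only [blockChannel]
  rw [← Fintype.prod_sum (fun j y => V (q j) (fun i => t i j) y)]
  simp

lemma blockChannel_le_one (q : Fin n → 𝒬) (t : ∀ i, Fin n → 𝒯 i) (y : Fin n → 𝒴) :
    blockChannel V q t y ≤ 1 :=
  prod_le_one (fun _ _ => stdSimplex.zero_le _ _) fun _ _ => stdSimplex.le_one _ _

lemma prodLaw_blockLaw (q : Fin n → 𝒬) (t : ∀ i, Fin n → 𝒯 i) :
    prodLaw (blockLaw pT q) t = ∏ j, prodLaw (fun i => pT i (q j)) (fun i => t i j) := by
  simp only [prodLaw, blockLaw]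
  exact prod_comm

/-- The conditional output laws of the memoryless extension are products. -/
lemma partialLaw_block (q : Fin n → 𝒬) (A : Finset ι) (t : ∀ i, Fin n → 𝒯 i) (y : Fin n → 𝒴) :
    partialLaw (blockLaw pT q) (fun t => blockChannel V q t y) A t =
      ∏ j, letterCond pT V A (q j, (fun i => t i j), y j) := by
  simp only [partialLaw, letterCond, prodLaw_blockLaw, blockChannel]
  rw [Fintype.prod_sum (fun j (t' : ∀ i, 𝒯 i) => prodLaw (fun i => pT i (q j)) t' *
    V (q j) (A.piecewise (fun i => t i j) t') (y j)),
    ← (Equiv.piComm (fun (_ : Fin n) (i : ι) => 𝒯 i)).sum_comp]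
  refine sum_congr rfl fun t' _ => ?_
  rw [← prod_mul_distrib]
  refine prod_congr rfl fun j _ => ?_
  congr 2
  congr 1
  ext i
  by_cases hi : i ∈ A <;> simp [hi, Equiv.piComm, Function.swap]

lemma letterLaw_nonneg (ω : 𝒬 × (∀ i, 𝒯 i) × 𝒴) : 0 ≤ letterLaw pQ pT V ω :=
  mul_nonneg (mul_nonneg (stdSimplex.zero_le _ _)
    (prodLaw_nonneg (fun _ _ => stdSimplex.zero_le _ _) _)) (stdSimplex.zero_le _ _)

lemma sum_letterLaw : ∑ ω, letterLaw pQ pT V ω = 1 := by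
  simp only [letterLaw, Fintype.sum_prod_type, ← mul_sum, stdSimplex.sum_eq_one, mul_one]
  rw [sum_congr rfl fun q _ => by
    rw [sum_prodLaw (p := fun i => pT i q) (fun i => stdSimplex.sum_eq_one _), mul_one]]
  simp

lemma letterCond_pos (A : Finset ι) {ω : 𝒬 × (∀ i, 𝒯 i) × 𝒴} (h : 0 < letterLaw pQ pT V ω) :
    0 < letterCond pT V A ω := by
  have h0 := prodLaw_nonneg (p := fun i => pT i ω.1) (fun _ _ => stdSimplex.zero_le _ _) ω.2.1
  have h1 : prodLaw (fun i => pT i ω.1) ω.2.1 ≠ 0 := fun h' => by simp [letterLaw, h'] at h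
  have h2 : V ω.1 ω.2.1 ω.2.2 ≠ 0 := fun h' => by simp [letterLaw, h'] at h
  exact partialLaw_pos (fun _ _ => stdSimplex.zero_le _ _) (fun _ => stdSimplex.zero_le _ _) A
    (h0.lt_of_ne' h1) ((stdSimplex.zero_le _ _).lt_of_ne' h2)

/-- Expectations over a block as sums over sequences of letters. -/
lemma sum_block (F : (Fin n → 𝒬) → (∀ i, Fin n → 𝒯 i) → (Fin n → 𝒴) → ℝ) :
    ∑ q : Fin n → 𝒬, (∏ j, pQ (q j)) * ∑ t, prodLaw (blockLaw pT q) t *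
      ∑ y, blockChannel V q t y * F q t y =
    ∑ ω : Fin n → 𝒬 × (∀ i, 𝒯 i) × 𝒴, (∏ j, letterLaw pQ pT V (ω j)) *
      F (fun j => (ω j).1) (fun i j => (ω j).2.1 i) (fun j => (ω j).2.2) := by
  let e : (Fin n → 𝒬 × (∀ i, 𝒯 i) × 𝒴) ≃ (Fin n → 𝒬) × (∀ i, Fin n → 𝒯 i) × (Fin n → 𝒴) :=
    { toFun := fun ω => (fun j => (ω j).1, fun i j => (ω j).2.1 i, fun j => (ω j).2.2)
      invFun := fun x j => (x.1 j, fun i => x.2.1 i j, x.2.2 j)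
      left_inv := fun _ => rfl
      right_inv := fun _ => rfl }
  simp_rw [mul_sum]
  rw [← e.symm.sum_comp, Fintype.sum_prod_type]
  refine sum_congr rfl fun q _ => ?_
  rw [Fintype.sum_prod_type]
  refine sum_congr rfl fun t _ => sum_congr rfl fun y _ => ?_
  simp only [e, letterLaw, prodLaw_blockLaw, blockChannel, prod_mul_distrib, Equiv.coe_fn_symm_mk]
  ring

/-- The sequence `ω` is typical for all conditional output laws. -/
def IsTypical (η : ℝ) (ω : Fin n → 𝒬 × (∀ i, 𝒯 i) × 𝒴) : Prop :=
  ∀ A : Finset ι, |∑ j, Real.log (letterCond pT V A (ω j)) - n * logLikelihood pQ pT V A| < n * η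

-- A union bound over `A` of Chebyshev's inequality. The decay `1 / n` is just fast enough for
-- `exists_sum_log_softCovering_le`, where atypical sequences cost a term linear in `n`.
open scoped Classical in
lemma exists_sum_not_isTypical_le {η : ℝ} (hη : 0 < η) : ∃ C, 0 ≤ C ∧ ∀ n : ℕ, 0 < n →
    ∑ ω : Fin n → 𝒬 × (∀ i, 𝒯 i) × 𝒴, (∏ j, letterLaw pQ pT V (ω j)) *
      (if IsTypical pQ pT V η ω then 0 else 1) ≤ C / n := by
  have hP0 := letterLaw_nonneg pQ pT V
  refine ⟨∑ A : Finset ι, (∑ x, letterLaw pQ pT V x * (Real.log (letterCond pT V A x) -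
    logLikelihood pQ pT V A) ^ 2) / η ^ 2, ?_, fun n hn => ?_⟩
  · exact sum_nonneg fun A _ => div_nonneg (sum_nonneg fun x _ => mul_nonneg (hP0 x) (sq_nonneg _))
      (sq_nonneg _)
  rw [sum_div]
  refine le_trans ?_ (sum_le_sum fun A _ => sum_prod_deviation_le hP0 (sum_letterLaw pQ pT V)
    (fun x => Real.log (letterCond pT V A x)) hη hn)
  rw [sum_comm]
  refine sum_le_sum fun ω _ => ?_
  rw [← mul_sum]
  refine mul_le_mul_of_nonneg_left ?_ (prod_nonneg fun j _ => hP0 _)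
  have hnn : ∀ A ∈ (univ : Finset (Finset ι)), (0 : ℝ) ≤
      if n * η ≤ |∑ j, Real.log (letterCond pT V A (ω j)) -
        n * ∑ x, letterLaw pQ pT V x * Real.log (letterCond pT V A x)| then 1 else 0 :=
    fun A _ => by split_ifs <;> norm_num
  split_ifs with h
  · exact sum_nonneg hnn
  · simp only [IsTypical, not_forall, not_lt] at h
    obtain ⟨A, hA⟩ := h
    refine le_trans ?_ (single_le_sum hnn (mem_univ A))
    rw [logLikelihood] at hA
    rw [if_pos hA]

/-- The positivity of every letter matters: since `Real.log 0 = 0`, the logarithm of the product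
would not split off the support. -/
lemma log_partialLaw_block (A : Finset ι) {ω : Fin n → 𝒬 × (∀ i, 𝒯 i) × 𝒴}
    (hω : ∀ j, 0 < letterLaw pQ pT V (ω j)) :
    0 < partialLaw (blockLaw pT fun j => (ω j).1)
      (fun t => blockChannel V (fun j => (ω j).1) t fun j => (ω j).2.2) A (fun i j => (ω j).2.1 i) ∧
    Real.log (partialLaw (blockLaw pT fun j => (ω j).1)
      (fun t => blockChannel V (fun j => (ω j).1) t fun j => (ω j).2.2) A
        (fun i j => (ω j).2.1 i)) = ∑ j, Real.log (letterCond pT V A (ω j)) := by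
  rw [partialLaw_block]
  exact ⟨prod_pos fun j _ => letterCond_pos pQ pT V A (hω j),
    Real.log_prod fun j _ => (letterCond_pos pQ pT V A (hω j)).ne'⟩

/-- The threshold for the error pattern `S` of the decoder of the layers in `D`. -/
noncomputable def decodingThreshold (n : ℕ) (η : ℝ) (D S : Finset ι) : ℝ :=
  n * (logLikelihood pQ pT V D - logLikelihood pQ pT V (D \ S) - 2 * η)

open scoped Classical in
/-- The transmitted codewords pass the decoding test with high probability. -/
lemma exists_sum_not_decodingTest_le {η : ℝ} (hη : 0 < η) (D E : Finset ι) :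
    ∃ C, 0 ≤ C ∧ ∀ n : ℕ, 0 < n →
    ∑ q : Fin n → 𝒬, (∏ j, pQ (q j)) * ∑ t, prodLaw (blockLaw pT q) t *
      ∑ y, blockChannel V q t y * (if DecodingTest (blockLaw pT q) (blockChannel V q) D E
        (decodingThreshold pQ pT V n η D) t y then 0 else 1) ≤ C / n := by
  obtain ⟨C, hC, h⟩ := exists_sum_not_isTypical_le pQ pT V hη
  refine ⟨C, hC, fun n hn => le_trans ?_ (h n hn)⟩
  rw [sum_block]
  refine sum_le_sum fun ω _ => ?_
  have hprod : 0 ≤ ∏ j, letterLaw pQ pT V (ω j) := prod_nonneg fun j _ => letterLaw_nonneg _ _ _ _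
  rcases hprod.eq_or_lt with h0 | h0
  · simp [← h0]
  have hω : ∀ j, 0 < letterLaw pQ pT V (ω j) := fun j =>
    (letterLaw_nonneg _ _ _ _).lt_of_ne' (prod_ne_zero_iff.1 h0.ne' j (mem_univ j))
  refine mul_le_mul_of_nonneg_left ?_ hprod
  by_cases ht : IsTypical pQ pT V η ω
  · rw [if_pos, if_pos ht]
    intro S _ _
    obtain ⟨hD, hDl⟩ := log_partialLaw_block pQ pT V D hω
    obtain ⟨hS, hSl⟩ := log_partialLaw_block pQ pT V (D \ S) hω
    rw [← Real.log_le_log_iff (mul_pos (Real.exp_pos _) hS) hD,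
      Real.log_mul (Real.exp_pos _).ne' hS.ne', Real.log_exp, hDl, hSl, decodingThreshold]
    -- Each typicality bound costs `η`, which accounts for the `2 * η` in `decodingThreshold`.
    have h1 := (abs_lt.1 (ht D)).1
    have h2 := (abs_lt.1 (ht (D \ S))).2
    linarith
  · rw [if_neg ht]
    split_ifs <;> norm_num

/-- Finite alphabets give a uniform floor for the positive output probabilities. The cap at `1`
makes `-Real.log c` nonnegative and covers the case without positive values. -/
lemma exists_pos_le_of_pos {α : Type*} [Finite α] (f : α → ℝ) :
    ∃ c, 0 < c ∧ c ≤ 1 ∧ ∀ x, 0 < f x → c ≤ f x := by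
  classical
  cases nonempty_fintype α
  rcases (univ.filter fun x => 0 < f x).eq_empty_or_nonempty with h | h
  · refine ⟨1, one_pos, le_rfl, fun x hx => ?_⟩
    exact absurd (mem_filter.2 ⟨mem_univ x, hx⟩) (by rw [h]; simp)
  · obtain ⟨x, hx, hmin⟩ := exists_min_image _ f h
    refine ⟨min (f x) 1, lt_min (mem_filter.1 hx).2 one_pos, min_le_right _ _, fun y hy => ?_⟩
    exact (min_le_left _ _).trans (hmin y (mem_filter.2 ⟨mem_univ y, hy⟩))

/-- The divergence bound is bounded uniformly in the block length when the randomization rates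
`ρ` exceed the information rates. -/
lemma exists_sum_log_softCovering_le {η : ℝ} (hη : 0 < η) (ρ : ι → ℝ)
    (hρ0 : ∀ i, 0 ≤ ρ i)
    (hρ : ∀ A : Finset ι, A.Nonempty →
      logLikelihood pQ pT V A - logLikelihood pQ pT V ∅ + 2 * η ≤ ∑ i ∈ A, ρ i) :
    ∃ C, 0 ≤ C ∧ ∀ n : ℕ, 0 < n → ∀ N : ι → ℝ, (∀ i, Real.exp (n * ρ i) ≤ N i) →
    ∑ q : Fin n → 𝒬, (∏ j, pQ (q j)) * ∑ t, prodLaw (blockLaw pT q) t *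
      ∑ y, blockChannel V q t y *
        Real.log (softCovering (blockLaw pT q) (blockChannel V q) N t y) ≤ C := by
  classical
  obtain ⟨C, hC, hCn⟩ := exists_sum_not_isTypical_le pQ pT V hη
  obtain ⟨c, hc, hc1, hcle⟩ := exists_pos_le_of_pos (letterCond pT V ∅)
  set κ : ℝ := (Fintype.card (Finset ι) : ℝ) with hκ
  have hκ1 : 1 ≤ κ := by
    rw [hκ]; exact_mod_cast Fintype.card_pos
  have hlogc : 0 ≤ -Real.log c := neg_nonneg.2 (Real.log_nonpos hc.le hc1)
  -- On typical sequences each of the `κ` terms of `softCovering` is at most `1`. On the others each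
  -- is at most `c⁻ⁿ`, which costs `n * (-Real.log c)` with probability at most `C / n`.
  refine ⟨Real.log κ + C * (-Real.log c), add_nonneg (Real.log_nonneg hκ1) (mul_nonneg hC hlogc),
    fun n hn N hN => ?_⟩
  have hn' : (0 : ℝ) < n := Nat.cast_pos.2 hn
  have hN1 : ∀ i, 1 ≤ N i := fun i =>
    (Real.one_le_exp (mul_nonneg hn'.le (hρ0 i))).trans (hN i)
  rw [sum_block]
  have key : ∀ ω : Fin n → 𝒬 × (∀ i, 𝒯 i) × 𝒴, (∏ j, letterLaw pQ pT V (ω j)) *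
      Real.log (softCovering (blockLaw pT fun j => (ω j).1) (blockChannel V fun j => (ω j).1) N
        (fun i j => (ω j).2.1 i) (fun j => (ω j).2.2)) ≤
      (∏ j, letterLaw pQ pT V (ω j)) * Real.log κ +
      (∏ j, letterLaw pQ pT V (ω j)) * (if IsTypical pQ pT V η ω then 0 else 1) *
        (n * (-Real.log c)) := by
    intro ω
    have hprod : 0 ≤ ∏ j, letterLaw pQ pT V (ω j) :=
      prod_nonneg fun j _ => letterLaw_nonneg _ _ _ _
    rcases hprod.eq_or_lt with h0 | h0
    · simp [← h0]
    have hω : ∀ j, 0 < letterLaw pQ pT V (ω j) := fun j =>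
      (letterLaw_nonneg _ _ _ _).lt_of_ne' (prod_ne_zero_iff.1 h0.ne' j (mem_univ j))
    rw [mul_assoc, ← mul_add]
    refine mul_le_mul_of_nonneg_left ?_ hprod
    set G : Finset ι → ℝ := fun A => partialLaw (blockLaw pT fun j => (ω j).1)
      (fun t => blockChannel V (fun j => (ω j).1) t fun j => (ω j).2.2) A
        (fun i j => (ω j).2.1 i) with hG
    have hGl : ∀ A, 0 < G A ∧ Real.log (G A) = ∑ j, Real.log (letterCond pT V A (ω j)) :=
      fun A => log_partialLaw_block pQ pT V A hω
    have hsc : softCovering (blockLaw pT fun j => (ω j).1) (blockChannel V fun j => (ω j).1) N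
        (fun i j => (ω j).2.1 i) (fun j => (ω j).2.2) =
        ∑ A : Finset ι, (∏ i ∈ A, N i)⁻¹ * (G A / G ∅) := rfl
    have hNA : ∀ A : Finset ι, 0 < ∏ i ∈ A, N i := fun A =>
      prod_pos fun i _ => one_pos.trans_le (hN1 i)
    have hterm : ∀ A : Finset ι, 0 < (∏ i ∈ A, N i)⁻¹ * (G A / G ∅) := fun A =>
      mul_pos (inv_pos.2 (hNA A)) (div_pos (hGl A).1 (hGl ∅).1)
    have hpos : 0 < ∑ A : Finset ι, (∏ i ∈ A, N i)⁻¹ * (G A / G ∅) :=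
      sum_pos (fun A _ => hterm A) univ_nonempty
    rw [hsc]
    split_ifs with ht
    · rw [zero_mul, add_zero]
      refine Real.log_le_log hpos ?_
      have : ∀ A ∈ (univ : Finset (Finset ι)), (∏ i ∈ A, N i)⁻¹ * (G A / G ∅) ≤ 1 := by
        intro A _
        rcases A.eq_empty_or_nonempty with rfl | hA
        · simp [div_self (hGl ∅).1.ne']
        rw [inv_mul_le_iff₀ (hNA A), mul_one]
        have h1 : Real.exp (n * ∑ i ∈ A, ρ i) ≤ ∏ i ∈ A, N i := by
          rw [mul_sum, Real.exp_sum]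
          exact prod_le_prod (fun i _ => (Real.exp_pos _).le) fun i _ => hN i
        refine le_trans ?_ h1
        rw [← Real.log_le_iff_le_exp (div_pos (hGl A).1 (hGl ∅).1),
          Real.log_div (hGl A).1.ne' (hGl ∅).1.ne', (hGl A).2, (hGl ∅).2]
        have h2 := (abs_lt.1 (ht A)).2
        have h3 := (abs_lt.1 (ht ∅)).1
        have h4 := mul_le_mul_of_nonneg_left (hρ A hA) hn'.le
        linarith
      refine (sum_le_card_nsmul _ _ _ this).trans (le_of_eq ?_)
      rw [nsmul_eq_mul, mul_one, card_univ]
    · rw [one_mul]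
      -- Off the typical set only the crude ratio bound is left: numerator at most `1`, denominator
      -- a product of `n` positive letter probabilities.
      have hG0 : c ^ n ≤ G ∅ := by
        simp only [hG, partialLaw_block]
        refine le_trans (le_of_eq ?_) (prod_le_prod (s := (univ : Finset (Fin n)))
          (f := fun _ => c) (fun _ _ => hc.le)
          fun j _ => hcle (ω j) (letterCond_pos pQ pT V ∅ (hω j)))
        simp
      have : ∀ A ∈ (univ : Finset (Finset ι)), (∏ i ∈ A, N i)⁻¹ * (G A / G ∅) ≤ (c ^ n)⁻¹ := by
        intro A _
        have h1 : (∏ i ∈ A, N i)⁻¹ ≤ 1 := inv_le_one_of_one_le₀ (one_le_prod fun i _ => hN1 i)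
        have h2 : G A ≤ 1 := partialLaw_le_one (fun i t => blockLaw_nonneg pT _ i t)
          (fun i => sum_blockLaw pT _ i) (fun t => blockChannel_le_one V _ t _) A _
        calc _ ≤ 1 * (1 / c ^ n) := by
              refine mul_le_mul h1 ?_ (div_pos (hGl A).1 (hGl ∅).1).le zero_le_one
              exact div_le_div₀ zero_le_one h2 (pow_pos hc n) hG0
          _ = _ := by simp
      have hle := (sum_le_card_nsmul _ _ _ this)
      rw [nsmul_eq_mul, card_univ] at hle
      refine (Real.log_le_log hpos hle).trans (le_of_eq ?_)
      rw [Real.log_mul (by positivity) (by positivity), Real.log_inv, Real.log_pow]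
      ring
  refine (sum_le_sum fun ω _ => key ω).trans ?_
  rw [sum_add_distrib, ← sum_mul, ← sum_mul, sum_prod_law (sum_letterLaw pQ pT V), one_mul]
  refine add_le_add le_rfl ?_
  calc _ ≤ C / n * (n * (-Real.log c)) :=
        mul_le_mul_of_nonneg_right (hCn n hn) (mul_nonneg hn'.le hlogc)
    _ = C * (-Real.log c) := by field_simp

end Block

/-! ### Mutual informations as differences of log-likelihoods. -/

section Information

lemma marginal_eq_sum_filter {Ω α : Type*} [Fintype Ω] (p : Ω → ℝ) (f : Ω → α) (a : α)
    {P : Ω → Prop} [DecidablePred P] (hP : ∀ ω, f ω = a ↔ P ω) :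
    marginal p f a = ∑ ω with P ω, p ω := by
  unfold marginal
  refine sum_congr (Finset.ext fun ω => ?_) fun _ _ => rfl
  simp only [mem_filter, hP]

lemma marginal_marginal {Ω Ω' α : Type*} [Fintype Ω] [Fintype Ω'] (p : Ω → ℝ) (π : Ω → Ω')
    (f : Ω' → α) : marginal (marginal p π) f = marginal p (fun ω => f (π ω)) := by
  classical
  ext a
  have h := sum_marginal_mul p π (fun x => if f x = a then 1 else 0)
  simpa [marginal, sum_filter] using h

lemma condMutualInfo_marginal {Ω Ω' α β γ : Type*} [Fintype Ω] [Fintype Ω'] [Fintype α]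
    [Fintype β] [Fintype γ] (p : Ω → ℝ) (π : Ω → Ω') (f : Ω' → α) (g : Ω' → β) (h : Ω' → γ) :
    condMutualInfo (marginal p π) f g h =
      condMutualInfo p (fun ω => f (π ω)) (fun ω => g (π ω)) (fun ω => h (π ω)) := by
  simp only [condMutualInfo, condEntropy, entropy, marginal_marginal]

variable {ι : Type*} [Fintype ι] [DecidableEq ι] {𝒬 : Type*} [Fintype 𝒬] {𝒯 : ι → Type*}
  [∀ i, Fintype (𝒯 i)] {𝒴 : Type*} [Fintype 𝒴]
  (pQ : stdSimplex ℝ 𝒬) (pT : ∀ i, 𝒬 → stdSimplex ℝ (𝒯 i))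
  (V : 𝒬 → (∀ i, 𝒯 i) → stdSimplex ℝ 𝒴)

-- Fixing the coordinates in `A` splits off their probability by independence; what remains is the
-- conditional mean. This computes the marginals of `letterLaw`.
open scoped Classical in
lemma sum_prodLaw_mul_ite {T : ι → Type*} [∀ i, Fintype (T i)] {p : ∀ i, T i → ℝ}
    (hp : ∀ i, ∑ t, p i t = 1) (A : Finset ι) (V : (∀ i, T i) → ℝ) (t : ∀ i, T i) :
    ∑ t', prodLaw p t' * ((if ∀ i ∈ A, t i = t' i then 1 else 0) * V t') =
      (∏ i ∈ A, p i (t i)) * partialLaw p V A t := by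
  rw [← sum_prodLaw_mul_partialLaw hp A]
  · have h1 : ∀ t', prodLaw p t' * ((if ∀ i ∈ A, t i = t' i then 1 else 0) *
        partialLaw p V A t') =
        (∏ i, p i (t' i) * (if i ∈ A → t i = t' i then 1 else 0)) * partialLaw p V A t := by
      intro t'
      rw [prod_mul_distrib, prod_ite_zero]
      simp only [mem_univ, true_implies, prod_const_one]
      split_ifs with h
      · rw [partialLaw_congr p V h, prodLaw]; ring
      · simp
    simp_rw [h1]
    rw [← sum_mul, ← Fintype.prod_sum (fun i t' => p i t' * (if i ∈ A → t i = t' then 1 else 0))]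
    congr 1
    rw [← prod_subset (subset_univ A)]
    · exact prod_congr rfl fun i hi => by simp [hi]
    · intro i _ hi; simp [hi, hp]
  · intro s s'
    refine if_congr (forall₂_congr fun i hi => ?_) rfl rfl
    simp [hi]

open scoped Classical in
lemma sum_letterLaw_filter (A : Finset ι) (ω : 𝒬 × (∀ i, 𝒯 i) × 𝒴) :
    ∑ ω' with (ω.1 = ω'.1 ∧ ∀ i ∈ A, ω.2.1 i = ω'.2.1 i) ∧ ω.2.2 = ω'.2.2,
      letterLaw pQ pT V ω' =
      pQ ω.1 * (∏ i ∈ A, pT i ω.1 (ω.2.1 i)) * letterCond pT V A ω := by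
  obtain ⟨q, t, y⟩ := ω
  rw [sum_filter, Fintype.sum_prod_type, sum_eq_single q, Fintype.sum_prod_type]
  · have := sum_prodLaw_mul_ite (p := fun i => pT i q) (fun i => stdSimplex.sum_eq_one _) A
      (fun t => V q t y) t
    simp only [letterCond]
    rw [mul_assoc, ← this, mul_sum]
    refine sum_congr rfl fun t' _ => ?_
    rw [sum_eq_single y]
    · simp only [letterLaw, true_and, and_true]
      split_ifs <;> ring
    · intro y' _ hy; simp [Ne.symm hy]
    · simp
  · intro q' _ hq; simp [Ne.symm hq]
  · simp

open scoped Classical in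
lemma sum_letterLaw_filter' (A : Finset ι) (ω : 𝒬 × (∀ i, 𝒯 i) × 𝒴) :
    ∑ ω' with ω.1 = ω'.1 ∧ ∀ i ∈ A, ω.2.1 i = ω'.2.1 i, letterLaw pQ pT V ω' =
      pQ ω.1 * (∏ i ∈ A, pT i ω.1 (ω.2.1 i)) := by
  obtain ⟨q, t, y⟩ := ω
  rw [sum_filter, Fintype.sum_prod_type, sum_eq_single q, Fintype.sum_prod_type]
  · have := sum_prodLaw_mul_ite (p := fun i => pT i q) (fun i => stdSimplex.sum_eq_one _) A
      (fun _ => 1) t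
    have h1 : partialLaw (fun i => (pT i q : 𝒯 i → ℝ)) (fun _ => 1) A t = 1 := by
      simp [partialLaw, sum_prodLaw (p := fun i => pT i q) fun i => stdSimplex.sum_eq_one _]
    rw [h1, mul_one] at this
    simp only
    rw [← this, mul_sum]
    refine sum_congr rfl fun t' _ => ?_
    simp only [letterLaw, true_and, mul_one]
    split_ifs
    · rw [← mul_sum]; simp
    · simp
  · intro q' _ hq; simp [Ne.symm hq]
  · simp

/-- Conditional mutual information between layers and the output in terms of conditional output
laws. -/
lemma condMutualInfo_letterLaw {α γ : Type*} [Fintype α] [Fintype γ] (D D' : Finset ι)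
    (f : 𝒬 × (∀ i, 𝒯 i) × 𝒴 → α) (h : 𝒬 × (∀ i, 𝒯 i) × 𝒴 → γ)
    (hf : ∀ ω ω', (f ω' = f ω ∧ h ω' = h ω) ↔ (ω.1 = ω'.1 ∧ ∀ i ∈ D, ω.2.1 i = ω'.2.1 i))
    (hh : ∀ ω ω', h ω' = h ω ↔ (ω.1 = ω'.1 ∧ ∀ i ∈ D', ω.2.1 i = ω'.2.1 i)) :
    condMutualInfo (letterLaw pQ pT V) f (fun ω => ω.2.2) h * Real.log 2 =
      logLikelihood pQ pT V D - logLikelihood pQ pT V D' := by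
  classical
  rw [condMutualInfo_mul_log_two, logLikelihood, logLikelihood, ← sum_sub_distrib]
  refine sum_congr rfl fun ω _ => ?_
  rcases (letterLaw_nonneg pQ pT V ω).eq_or_lt with h0 | h0
  · simp [← h0]
  have hQ : pQ ω.1 ≠ 0 := fun h' => by simp [letterLaw, h'] at h0
  have hT : ∀ i, pT i ω.1 (ω.2.1 i) ≠ 0 := by
    intro i h'
    have : prodLaw (fun i => (pT i ω.1 : 𝒯 i → ℝ)) ω.2.1 = 0 := prod_eq_zero (mem_univ i) h'
    simp [letterLaw, this] at h0
  have hc : ∀ A : Finset ι, pQ ω.1 * (∏ i ∈ A, pT i ω.1 (ω.2.1 i)) ≠ 0 := fun A =>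
    mul_ne_zero hQ (prod_ne_zero_iff.2 fun i _ => hT i)
  have hG : ∀ A : Finset ι, letterCond pT V A ω ≠ 0 := fun A => (letterCond_pos pQ pT V A h0).ne'
  have e1 : marginal (letterLaw pQ pT V) (fun ω => (f ω, ω.2.2, h ω)) (f ω, ω.2.2, h ω) =
      pQ ω.1 * (∏ i ∈ D, pT i ω.1 (ω.2.1 i)) * letterCond pT V D ω := by
    rw [← sum_letterLaw_filter]
    refine marginal_eq_sum_filter _ _ _ fun ω' => ?_
    rw [← hf]
    simp only [Prod.mk.injEq, eq_comm (a := ω.2.2)]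
    tauto
  have e2 : marginal (letterLaw pQ pT V) (fun ω => (ω.2.2, h ω)) (ω.2.2, h ω) =
      pQ ω.1 * (∏ i ∈ D', pT i ω.1 (ω.2.1 i)) * letterCond pT V D' ω := by
    rw [← sum_letterLaw_filter]
    refine marginal_eq_sum_filter _ _ _ fun ω' => ?_
    rw [← hh]
    simp only [Prod.mk.injEq, eq_comm (a := ω.2.2)]
    tauto
  have e3 : marginal (letterLaw pQ pT V) (fun ω => (f ω, h ω)) (f ω, h ω) =
      pQ ω.1 * (∏ i ∈ D, pT i ω.1 (ω.2.1 i)) := by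
    rw [← sum_letterLaw_filter' pQ pT V]
    refine marginal_eq_sum_filter _ _ _ fun ω' => ?_
    rw [← hf]
    simp
  have e4 : marginal (letterLaw pQ pT V) h (h ω) =
      pQ ω.1 * (∏ i ∈ D', pT i ω.1 (ω.2.1 i)) := by
    rw [← sum_letterLaw_filter' pQ pT V, marginal_eq_sum_filter _ _ _ (hh ω)]
  -- The probabilities of `q` and of the layers in `D` and `D'` occur once with each sign and
  -- cancel, so only the conditional output laws survive.
  rw [e1, e2, e3, e4, Real.log_mul (hc D) (hG D), Real.log_mul (hc D') (hG D')]
  ring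

end Information

/-! ### From the admissible joint law to a channel from layers to an output. -/

section Channel

variable {𝒳₁ 𝒳₂ 𝒴₁ 𝒴₂ 𝒴ₑ : Type*} [Fintype 𝒳₁] [Fintype 𝒳₂]
  [Fintype 𝒴₁] [Fintype 𝒴₂] [Fintype 𝒴ₑ] {𝒬 : Type} [Fintype 𝒬]
  {𝒯 : Aux → Type} [∀ i, Fintype (𝒯 i)] {𝒴 : Type*} [Fintype 𝒴]
  (W : Channel 𝒳₁ 𝒳₂ 𝒴₁ 𝒴₂ 𝒴ₑ) (pX₁ : 𝒯 .C₁ → 𝒯 .S₁ → 𝒯 .O₁ → 𝒬 → stdSimplex ℝ 𝒳₁)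
  (pX₂ : 𝒯 .C₂ → 𝒯 .S₂ → 𝒯 .O₂ → 𝒬 → stdSimplex ℝ 𝒳₂)

/-- The law of a function of a random variable. -/
noncomputable def stdSimplex.marginal {Ω α : Type*} [Fintype Ω] [Fintype α] (s : stdSimplex ℝ Ω)
    (f : Ω → α) : stdSimplex ℝ α :=
  ⟨_root_.marginal s f, fun a => marginal_nonneg (stdSimplex.zero_le s) f a, by
    simpa using sum_marginal_mul s f (fun _ => 1)⟩

/-- The law of the output `Y` given the layers and the time sharing variable. -/
noncomputable def layerChannel (Y : 𝒴₁ × 𝒴₂ × 𝒴ₑ → 𝒴) (q : 𝒬) (t : ∀ i, 𝒯 i) :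
    stdSimplex ℝ 𝒴 :=
  stdSimplex.marginal (Ω := 𝒴₁ × 𝒴₂ × 𝒴ₑ)
    ⟨fun y => ∑ x₁, ∑ x₂, pX₁ (t .C₁) (t .S₁) (t .O₁) q x₁ * pX₂ (t .C₂) (t .S₂) (t .O₂) q x₂ *
      W x₁ x₂ y,
    fun y => sum_nonneg fun x₁ _ => sum_nonneg fun x₂ _ => mul_nonneg (mul_nonneg
      (stdSimplex.zero_le _ _) (stdSimplex.zero_le _ _)) (stdSimplex.zero_le _ _), by
    rw [sum_comm, sum_congr rfl fun x₁ _ => sum_comm]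
    simp_rw [← mul_sum, stdSimplex.sum_eq_one, mul_one, ← mul_sum, stdSimplex.sum_eq_one, mul_one,
      stdSimplex.sum_eq_one]⟩ Y

open scoped Classical in
lemma layerChannel_apply (Y : 𝒴₁ × 𝒴₂ × 𝒴ₑ → 𝒴) (q : 𝒬) (t : ∀ i, 𝒯 i) (y : 𝒴) :
    layerChannel W pX₁ pX₂ Y q t y =
      ∑ x₁, ∑ x₂, pX₁ (t .C₁) (t .S₁) (t .O₁) q x₁ * pX₂ (t .C₂) (t .S₂) (t .O₂) q x₂ *
        ∑ y' with Y y' = y, W x₁ x₂ y' := by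
  change _root_.marginal _ _ _ = _
  rw [_root_.marginal]
  change ∑ y' with Y y' = y, ∑ x₁, ∑ x₂, _ = _
  rw [sum_comm]
  refine sum_congr rfl fun x₁ _ => ?_
  rw [sum_comm]
  exact sum_congr rfl fun x₂ _ => (mul_sum _ _ _).symm

variable {W pX₁ pX₂} {pQ : stdSimplex ℝ 𝒬} {pT : ∀ i, 𝒬 → stdSimplex ℝ (𝒯 i)}
  {p : stdSimplex ℝ (JointAlphabet 𝒬 𝒯 𝒳₁ 𝒳₂ 𝒴₁ 𝒴₂ 𝒴ₑ)}

/-- Summing out the inputs and the other outputs absorbs the prefixes `pX₁`, `pX₂` into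
`layerChannel`. The information quantities of one output depend on this marginal only. -/
lemma marginal_eq_letterLaw
    (hp : ∀ (q : 𝒬) (t : ∀ i, 𝒯 i) (x₁ : 𝒳₁) (x₂ : 𝒳₂) (y : 𝒴₁ × 𝒴₂ × 𝒴ₑ),
      p (q, t, x₁, x₂, y) =
        pQ q * (∏ i, pT i q (t i)) * pX₁ (t .C₁) (t .S₁) (t .O₁) q x₁ *
          pX₂ (t .C₂) (t .S₂) (t .O₂) q x₂ * W x₁ x₂ y) (Y : 𝒴₁ × 𝒴₂ × 𝒴ₑ → 𝒴) :
    marginal (p : JointAlphabet 𝒬 𝒯 𝒳₁ 𝒳₂ 𝒴₁ 𝒴₂ 𝒴ₑ → ℝ)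
      (fun ω => (ω.1, ω.2.1, Y ω.2.2.2.2)) =
      letterLaw pQ pT (layerChannel W pX₁ pX₂ Y) := by
  classical
  ext ⟨q, t, y⟩
  rw [marginal, sum_filter, Fintype.sum_prod_type, sum_eq_single q, Fintype.sum_prod_type,
    sum_eq_single t]
  · simp only [letterLaw, layerChannel_apply, Fintype.sum_prod_type (α₁ := 𝒳₁),
      Fintype.sum_prod_type (α₁ := 𝒳₂), mul_sum]
    refine sum_congr rfl fun x₁ _ => sum_congr rfl fun x₂ _ => ?_
    rw [sum_filter]
    refine sum_congr rfl fun y' _ => ?_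
    simp only [Prod.mk.injEq, true_and, hp, prodLaw]
    split_ifs <;> ring
  · intro t' _ ht; simp [ht]
  · simp
  · intro q' _ hq; simp [hq]
  · simp

lemma auxInfo_mul_log_two
    (hp : ∀ (q : 𝒬) (t : ∀ i, 𝒯 i) (x₁ : 𝒳₁) (x₂ : 𝒳₂) (y : 𝒴₁ × 𝒴₂ × 𝒴ₑ),
      p (q, t, x₁, x₂, y) =
        pQ q * (∏ i, pT i q (t i)) * pX₁ (t .C₁) (t .S₁) (t .O₁) q x₁ *
          pX₂ (t .C₂) (t .S₂) (t .O₂) q x₂ * W x₁ x₂ y) (Y : 𝒴₁ × 𝒴₂ × 𝒴ₑ → 𝒴)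
    (D S : Finset Aux) (hS : S ⊆ D) :
    auxInfo p Y D S * Real.log 2 =
      logLikelihood pQ pT (layerChannel W pX₁ pX₂ Y) D -
        logLikelihood pQ pT (layerChannel W pX₁ pX₂ Y) (D \ S) := by
  have h := condMutualInfo_marginal (p : JointAlphabet 𝒬 𝒯 𝒳₁ 𝒳₂ 𝒴₁ 𝒴₂ 𝒴ₑ → ℝ)
    (fun ω => (ω.1, ω.2.1, Y ω.2.2.2.2))
    (fun ω : 𝒬 × (∀ i, 𝒯 i) × 𝒴 => S.restrict ω.2.1) (fun ω => ω.2.2)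
    (fun ω => ((D \ S).restrict ω.2.1, ω.1))
  rw [marginal_eq_letterLaw hp Y] at h
  rw [auxInfo, ← h]
  have hr : ∀ (A : Finset Aux) (t t' : ∀ i, 𝒯 i),
      A.restrict t' = A.restrict t ↔ ∀ i ∈ A, t i = t' i := by
    intro A t t'
    simp [funext_iff, eq_comm]
  refine condMutualInfo_letterLaw pQ pT _ D (D \ S) _ _ (fun ω ω' => ?_) (fun ω ω' => ?_)
  · simp only [Prod.mk.injEq, hr, eq_comm (a := ω'.1)]
    constructor
    · rintro ⟨h1, h2, h3⟩
      refine ⟨h3, fun i hi => ?_⟩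
      by_cases hiS : i ∈ S
      · exact h1 i hiS
      · exact h2 i (mem_sdiff.2 ⟨hi, hiS⟩)
    · rintro ⟨h1, h2⟩
      exact ⟨fun i hi => h2 i (hS hi), fun i hi => h2 i (mem_sdiff.1 hi).1, h1⟩
  · simp only [Prod.mk.injEq, hr, eq_comm (a := ω'.1)]
    tauto

lemma condMutualInfo_layers_mul_log_two
    (hp : ∀ (q : 𝒬) (t : ∀ i, 𝒯 i) (x₁ : 𝒳₁) (x₂ : 𝒳₂) (y : 𝒴₁ × 𝒴₂ × 𝒴ₑ),
      p (q, t, x₁, x₂, y) =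
        pQ q * (∏ i, pT i q (t i)) * pX₁ (t .C₁) (t .S₁) (t .O₁) q x₁ *
          pX₂ (t .C₂) (t .S₂) (t .O₂) q x₂ * W x₁ x₂ y) (Y : 𝒴₁ × 𝒴₂ × 𝒴ₑ → 𝒴) :
    condMutualInfo (p : JointAlphabet 𝒬 𝒯 𝒳₁ 𝒳₂ 𝒴₁ 𝒴₂ 𝒴ₑ → ℝ)
      (fun ω => ω.2.1) (fun ω => Y ω.2.2.2.2) (fun ω => ω.1) * Real.log 2 =
      logLikelihood pQ pT (layerChannel W pX₁ pX₂ Y) univ -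
        logLikelihood pQ pT (layerChannel W pX₁ pX₂ Y) ∅ := by
  have h := condMutualInfo_marginal (p : JointAlphabet 𝒬 𝒯 𝒳₁ 𝒳₂ 𝒴₁ 𝒴₂ 𝒴ₑ → ℝ)
    (fun ω => (ω.1, ω.2.1, Y ω.2.2.2.2))
    (fun ω : 𝒬 × (∀ i, 𝒯 i) × 𝒴 => ω.2.1) (fun ω => ω.2.2) (fun ω => ω.1)
  rw [marginal_eq_letterLaw hp Y] at h
  rw [← h]
  refine condMutualInfo_letterLaw pQ pT _ univ ∅ _ _ (fun ω ω' => ?_) (fun ω ω' => ?_)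
  · simp only [mem_univ, true_implies, funext_iff, eq_comm (a := ω'.1)]
    constructor
    · rintro ⟨h1, h2⟩; exact ⟨h2, fun i => (h1 i).symm⟩
    · rintro ⟨h1, h2⟩; exact ⟨fun i => (h2 i).symm, h1⟩
  · simp [eq_comm]

end Channel

/-! ### From divergence to equivocation. -/

section Leakage

/-- Gibbs' inequality. -/
lemma gibbs_inequality {ζ : Type*} [Fintype ζ] {a Q : ζ → ℝ} (ha : ∀ z, 0 ≤ a z)
    (hQ : ∀ z, 0 ≤ Q z) (haQ : ∀ z, 0 < a z → 0 < Q z) (hle : ∑ z, Q z ≤ ∑ z, a z) :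
    0 ≤ ∑ z, a z * Real.log (a z / Q z) := by
  have h : ∀ z ∈ univ, a z - Q z ≤ a z * Real.log (a z / Q z) := by
    intro z _
    rcases (ha z).eq_or_lt with h0 | h0
    · simp [← h0, hQ z]
    · have hq := haQ z h0
      have := mul_le_mul_of_nonneg_left (Real.log_le_sub_one_of_pos (div_pos hq h0)) h0.le
      rw [Real.log_div hq.ne' h0.ne', mul_sub, mul_sub, mul_div_cancel₀ _ h0.ne'] at this
      rw [Real.log_div h0.ne' hq.ne', mul_sub]
      linarith
  refine le_trans ?_ (sum_le_sum h)
  rw [sum_sub_distrib]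
  linarith

/-- The equivocation of a uniform message is at least its entropy minus the mean divergence between
the conditional laws of the observation and a reference law. -/
lemma le_condEntropy_of_divergence {μ ζ Ω : Type*} [Fintype μ] [Nonempty μ] [Fintype ζ] [Fintype Ω]
    {p : Ω → ℝ} {f : Ω → μ} {g : Ω → ζ} {P : μ → ζ → ℝ} {Q : ζ → ℝ}
    (hp : ∀ w z, marginal p (fun ω => (f ω, g ω)) (w, z) = (Fintype.card μ : ℝ)⁻¹ * P w z)
    (hP0 : ∀ w z, 0 ≤ P w z) (hP : ∀ w, ∑ z, P w z = 1) (hQ0 : ∀ z, 0 ≤ Q z)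
    (hQ : ∑ z, Q z ≤ 1) (hPQ : ∀ w z, 0 < P w z → 0 < Q z) :
    Real.log (Fintype.card μ) -
      (Fintype.card μ : ℝ)⁻¹ * ∑ w, ∑ z, P w z * Real.log (P w z / Q z) ≤
      condEntropy p f g * Real.log 2 := by
  classical
  have hM : (0 : ℝ) < Fintype.card μ := Nat.cast_pos.2 Fintype.card_pos
  set m : ℝ := (Fintype.card μ : ℝ) with hm
  have h2 : Real.log 2 ≠ 0 := (Real.log_pos one_lt_two).ne'
  have hg : ∀ z, marginal p g z = m⁻¹ * ∑ w, P w z := by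
    intro z
    have h1 := congrFun (marginal_marginal p (fun ω => (f ω, g ω)) Prod.snd) z
    rw [← h1, mul_sum]
    simp_rw [← hp]
    rw [marginal, sum_filter, Fintype.sum_prod_type]
    simp
  rw [condEntropy, sub_mul, entropy, entropy, div_mul_cancel₀ _ h2, div_mul_cancel₀ _ h2,
    Fintype.sum_prod_type]
  simp_rw [hp, hg]
  have e1 : ∀ w z, Real.negMulLog (m⁻¹ * P w z) =
      m⁻¹ * (P w z * Real.log m) - m⁻¹ * (P w z * Real.log (P w z)) := by
    intro w z
    rcases (hP0 w z).eq_or_lt with h0 | h0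
    · simp [← h0]
    · rw [Real.negMulLog, Real.log_mul (inv_pos.2 hM).ne' h0.ne', Real.log_inv]; ring
  have e2 : ∀ w z, P w z * Real.log (P w z / Q z) =
      P w z * Real.log (P w z) - P w z * Real.log (Q z) := by
    intro w z
    rcases (hP0 w z).eq_or_lt with h0 | h0
    · simp [← h0]
    · rw [Real.log_div h0.ne' (hPQ w z h0).ne']; ring
  set a : ζ → ℝ := fun z => m⁻¹ * ∑ w, P w z with ha
  have ha0 : ∀ z, 0 ≤ a z := fun z =>
    mul_nonneg (inv_pos.2 hM).le (sum_nonneg fun w _ => hP0 w z)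
  have haQ : ∀ z, 0 < a z → 0 < Q z := by
    intro z hz
    by_contra hcon
    have : ∀ w, P w z = 0 := fun w => by
      by_contra hne
      exact hcon (hPQ w z ((hP0 w z).lt_of_ne' hne))
    simp [ha, this] at hz
  have hasum : ∑ z, a z = 1 := by
    simp only [ha]
    rw [← mul_sum, sum_comm]
    simp [hP, hm]
  -- The two sides of the claim differ exactly by the divergence of the true output law `a` from the
  -- reference law `Q`, which Gibbs' inequality makes nonnegative.
  have hgibbs := gibbs_inequality ha0 hQ0 haQ (by rw [hasum]; exact hQ)
  have e3 : ∀ z, a z * Real.log (a z / Q z) =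
      -Real.negMulLog (a z) - m⁻¹ * ∑ w, P w z * Real.log (Q z) := by
    intro z
    rw [← sum_mul, ← mul_assoc]
    change _ = _ - a z * _
    rcases (ha0 z).eq_or_lt with h0 | h0
    · simp [← h0]
    · rw [Real.log_div h0.ne' (haQ z h0).ne', Real.negMulLog]; ring
  have t1 : ∑ w, ∑ z, Real.negMulLog (m⁻¹ * P w z) =
      Real.log m - m⁻¹ * ∑ w, ∑ z, P w z * Real.log (P w z) := by
    simp_rw [e1, sum_sub_distrib, ← mul_sum, ← sum_mul, hP]
    simp [← hm, hM.ne']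
  have t2 : ∑ w, ∑ z, P w z * Real.log (P w z / Q z) =
      ∑ w, ∑ z, P w z * Real.log (P w z) - ∑ w, ∑ z, P w z * Real.log (Q z) := by
    simp_rw [e2, sum_sub_distrib]
  have t3 : ∑ z, a z * Real.log (a z / Q z) =
      -∑ z, Real.negMulLog (a z) - m⁻¹ * ∑ w, ∑ z, P w z * Real.log (Q z) := by
    rw [sum_congr rfl fun z _ => e3 z, sum_sub_distrib, sum_neg_distrib, ← mul_sum, sum_comm]
  rw [t3] at hgibbs
  rw [t1, t2, mul_sub]
  linarith

end Leakage

/-! ### The stochastic encoders and the output law they induce. -/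

section Encoding

variable {𝒳₁ 𝒳₂ 𝒴₁ 𝒴₂ 𝒴ₑ : Type*} [Fintype 𝒳₁] [Fintype 𝒳₂]
  [Fintype 𝒴₁] [Fintype 𝒴₂] [Fintype 𝒴ₑ] {𝒬 : Type} [Fintype 𝒬]
  {𝒯 : Aux → Type} [∀ i, Fintype (𝒯 i)]

/-- The law of a sequence of independent letters. -/
def sequenceLaw {X : Type*} [Fintype X] {n : ℕ} (f : Fin n → stdSimplex ℝ X) :
    stdSimplex ℝ (Fin n → X) :=
  ⟨fun x => ∏ j, f j (x j), fun _ => prod_nonneg fun _ _ => stdSimplex.zero_le _ _, by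
    rw [← Fintype.prod_sum (fun j x => f j x)]; simp⟩

/-- The mixture of a finite family of laws with equal weights. -/
noncomputable def uniformMixture {β X : Type*} [Fintype β] [Nonempty β] [Fintype X]
    (f : β → stdSimplex ℝ X) : stdSimplex ℝ X :=
  ⟨fun x => (Fintype.card β : ℝ)⁻¹ * ∑ b, f b x,
    fun _ => mul_nonneg (by positivity) (sum_nonneg fun _ _ => stdSimplex.zero_le _ _), by
    rw [← mul_sum, sum_comm]; simp⟩

lemma sequenceLaw_apply {X : Type*} [Fintype X] {n : ℕ} (f : Fin n → stdSimplex ℝ X)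
    (x : Fin n → X) : sequenceLaw f x = ∏ j, f j (x j) := rfl

lemma uniformMixture_apply {β X : Type*} [Fintype β] [Nonempty β] [Fintype X]
    (f : β → stdSimplex ℝ X) (x : X) :
    uniformMixture f x = (Fintype.card β : ℝ)⁻¹ * ∑ b, f b x := rfl

/-- The signals of the first transmitter. -/
def firstLayers : Finset Aux := {.C₁, .S₁, .O₁}

variable (W : Channel 𝒳₁ 𝒳₂ 𝒴₁ 𝒴₂ 𝒴ₑ) (pX₁ : 𝒯 .C₁ → 𝒯 .S₁ → 𝒯 .O₁ → 𝒬 → stdSimplex ℝ 𝒳₁)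
  (pX₂ : 𝒯 .C₂ → 𝒯 .S₂ → 𝒯 .O₂ → 𝒬 → stdSimplex ℝ 𝒳₂)
  {n : ℕ} {α β : Aux → Type} [∀ i, Fintype (α i)] [∀ i, Fintype (β i)]
  [∀ i, Nonempty (β i)]

/-- The first encoder draws the randomization indices uniformly and sends the codewords through
`pX₁`. -/
noncomputable def encoder₁ (q : Fin n → 𝒬) (B : ∀ i, α i × β i → Fin n → 𝒯 i) (a : ∀ i, α i) :
    stdSimplex ℝ (Fin n → 𝒳₁) :=
  uniformMixture fun b : ∀ i, β i => sequenceLaw fun j =>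
    pX₁ (B .C₁ (a .C₁, b .C₁) j) (B .S₁ (a .S₁, b .S₁) j) (B .O₁ (a .O₁, b .O₁) j) (q j)

/-- The second encoder draws the randomization indices uniformly and sends the codewords through
`pX₂`. -/
noncomputable def encoder₂ (q : Fin n → 𝒬) (B : ∀ i, α i × β i → Fin n → 𝒯 i) (a : ∀ i, α i) :
    stdSimplex ℝ (Fin n → 𝒳₂) :=
  uniformMixture fun b : ∀ i, β i => sequenceLaw fun j =>
    pX₂ (B .C₂ (a .C₂, b .C₂) j) (B .S₂ (a .S₂, b .S₂) j) (B .O₂ (a .O₂, b .O₂) j) (q j)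

/-- Averaging over two independent uniform tuples that are merged is averaging over one. -/
lemma sum_sum_piecewise {ι : Type*} [Fintype ι] [DecidableEq ι] {β : ι → Type*}
    [∀ i, Fintype (β i)] [∀ i, Nonempty (β i)] (A : Finset ι) (H : (∀ i, β i) → ℝ) :
    (∏ i, (Fintype.card (β i) : ℝ))⁻¹ * ((∏ i, (Fintype.card (β i) : ℝ))⁻¹ *
      ∑ b, ∑ b', H (A.piecewise b b')) = (∏ i, (Fintype.card (β i) : ℝ))⁻¹ * ∑ b, H b := by
  have h := sum_prodLaw_piecewise (p := fun i (_ : β i) => (Fintype.card (β i) : ℝ)⁻¹)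
    (fun i => by simp) A H
  simp only [prodLaw, prod_inv_distrib, mul_assoc, ← mul_sum] at h
  exact h

lemma sum_sum_prod_mul {X₁ X₂ : Type*} [Fintype X₁] [Fintype X₂] (f₁ : Fin n → X₁ → ℝ)
    (f₂ : Fin n → X₂ → ℝ) (w : Fin n → X₁ → X₂ → ℝ) :
    ∑ x₁ : Fin n → X₁, ∑ x₂ : Fin n → X₂,
      (∏ j, f₁ j (x₁ j)) * (∏ j, f₂ j (x₂ j)) * ∏ j, w j (x₁ j) (x₂ j) =
    ∏ j, ∑ x₁, ∑ x₂, f₁ j x₁ * f₂ j x₂ * w j x₁ x₂ := by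
  rw [Fintype.prod_sum (fun j x₁ => ∑ x₂, f₁ j x₁ * f₂ j x₂ * w j x₁ x₂)]
  refine sum_congr rfl fun x₁ _ => ?_
  rw [Fintype.prod_sum (fun j x₂ => f₁ j (x₁ j) * f₂ j x₂ * w j (x₁ j) x₂)]
  simp only [prod_mul_distrib]

lemma sum_sum_mixture_mul {X₁ X₂ β : Type*} [Fintype X₁] [Fintype X₂] [Fintype β] (N : ℝ)
    (f : β → X₁ → ℝ) (g : β → X₂ → ℝ) (w : X₁ → X₂ → ℝ) :
    ∑ x₁, ∑ x₂, (N * ∑ b, f b x₁) * (N * ∑ b, g b x₂) * w x₁ x₂ =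
      N * (N * ∑ b, ∑ b', ∑ x₁, ∑ x₂, f b x₁ * g b' x₂ * w x₁ x₂) := by
  have h : ∀ x₁ x₂, (N * ∑ b, f b x₁) * (N * ∑ b, g b x₂) * w x₁ x₂ =
      N * (N * ∑ b, ∑ b', f b x₁ * g b' x₂ * w x₁ x₂) := by
    intro x₁ x₂
    simp_rw [mul_assoc (f _ _), ← mul_sum, ← sum_mul]
    ring
  simp_rw [h, ← mul_sum]
  congr 2
  rw [sum_congr rfl fun x₁ _ => sum_comm, sum_comm]
  refine sum_congr rfl fun b _ => ?_
  rw [sum_congr rfl fun x₁ _ => sum_comm, sum_comm]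

/-- The output law of the random code. -/
lemma sum_encoder_mul (q : Fin n → 𝒬) (B : ∀ i, α i × β i → Fin n → 𝒯 i) (a₁ a₂ : ∀ i, α i)
    (y : Fin n → 𝒴₁ × 𝒴₂ × 𝒴ₑ) :
    ∑ x₁ : Fin n → 𝒳₁, ∑ x₂ : Fin n → 𝒳₂,
      encoder₁ pX₁ q B a₁ x₁ * encoder₂ pX₂ q B a₂ x₂ * ∏ j, W (x₁ j) (x₂ j) (y j) =
    inducedLaw (blockChannel (layerChannel W pX₁ pX₂ id) q) B
      (firstLayers.piecewise a₁ a₂) y := by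
  classical
  -- Each encoder draws randomization for all six layers but reads only its own three, so the two
  -- independent draws merge into one uniform tuple.
  rw [inducedLaw, ← sum_sum_piecewise firstLayers]
  simp only [encoder₁, encoder₂, uniformMixture_apply, Fintype.card_pi, Nat.cast_prod,
    sequenceLaw_apply]
  set N : ℝ := (∏ i, (Fintype.card (β i) : ℝ))⁻¹
  have h : ∀ b b' : ∀ i, β i, blockChannel (layerChannel W pX₁ pX₂ id) q
      (codeword B fun i => (firstLayers.piecewise a₁ a₂ i, firstLayers.piecewise b b' i)) y =
      ∑ x₁ : Fin n → 𝒳₁, ∑ x₂ : Fin n → 𝒳₂,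
      (∏ j, pX₁ (B .C₁ (a₁ .C₁, b .C₁) j) (B .S₁ (a₁ .S₁, b .S₁) j) (B .O₁ (a₁ .O₁, b .O₁) j)
        (q j) (x₁ j)) *
      (∏ j, pX₂ (B .C₂ (a₂ .C₂, b' .C₂) j) (B .S₂ (a₂ .S₂, b' .S₂) j)
        (B .O₂ (a₂ .O₂, b' .O₂) j) (q j) (x₂ j)) *
      ∏ j, W (x₁ j) (x₂ j) (y j) := by
    intro b b'
    have h1 := sum_sum_prod_mul
      (fun j x => pX₁ (B .C₁ (a₁ .C₁, b .C₁) j) (B .S₁ (a₁ .S₁, b .S₁) j)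
        (B .O₁ (a₁ .O₁, b .O₁) j) (q j) x)
      (fun j x => pX₂ (B .C₂ (a₂ .C₂, b' .C₂) j) (B .S₂ (a₂ .S₂, b' .S₂) j)
        (B .O₂ (a₂ .O₂, b' .O₂) j) (q j) x) (fun j x₁ x₂ => W x₁ x₂ (y j))
    rw [h1, blockChannel]
    refine prod_congr rfl fun j _ => ?_
    rw [layerChannel_apply]
    simp [codeword, firstLayers, Finset.piecewise, filter_eq']
  simp_rw [h]
  exact sum_sum_mixture_mul _ _ _ _

open scoped Classical in
lemma sum_prod_mul_comp {Z Y : Type*} [Fintype Z] [Fintype Y] (v : Fin n → Z → ℝ) (g : Z → Y)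
    (F : (Fin n → Y) → ℝ) :
    ∑ z : Fin n → Z, (∏ j, v j (z j)) * F (fun j => g (z j)) =
      ∑ y : Fin n → Y, (∏ j, ∑ z with g z = y j, v j z) * F y := by
  have h : ∀ y : Fin n → Y, ∏ j, ∑ z with g z = y j, v j z =
      ∑ z : Fin n → Z, (∏ j, v j (z j)) * (if (fun j => g (z j)) = y then 1 else 0) := by
    intro y
    simp_rw [sum_filter]
    rw [Fintype.prod_sum (fun j z => if g z = y j then v j z else 0)]
    refine sum_congr rfl fun z _ => ?_
    rw [prod_ite_zero]
    simp [funext_iff]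
  simp_rw [h, sum_mul]
  rw [sum_comm]
  refine sum_congr rfl fun z _ => ?_
  simp

/-- The law of an output is a marginal of the law of all outputs. -/
lemma sum_inducedLaw_mul_comp {𝒴 : Type*} [Fintype 𝒴] (Y : 𝒴₁ × 𝒴₂ × 𝒴ₑ → 𝒴) (q : Fin n → 𝒬)
    (B : ∀ i, α i × β i → Fin n → 𝒯 i) (a : ∀ i, α i) (F : (Fin n → 𝒴) → ℝ) :
    ∑ y, inducedLaw (blockChannel (layerChannel W pX₁ pX₂ id) q) B a y *
      F (fun j => Y (y j)) =
    ∑ z, inducedLaw (blockChannel (layerChannel W pX₁ pX₂ Y) q) B a z * F z := by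
  classical
  simp only [inducedLaw, mul_assoc, sum_mul, ← mul_sum]
  rw [sum_comm, sum_comm (s := (univ : Finset (Fin n → 𝒴)))]
  congr 1
  refine sum_congr rfl fun b _ => ?_
  simp only [blockChannel]
  rw [sum_prod_mul_comp (fun j y => layerChannel W pX₁ pX₂ id (q j)
    (fun i => codeword B (fun i => (a i, b i)) i j) y) Y F]
  refine sum_congr rfl fun z _ => ?_
  congr 1
  refine prod_congr rfl fun j _ => ?_
  simp only [layerChannel_apply]
  rw [sum_comm]
  refine sum_congr rfl fun x₁ _ => ?_
  rw [sum_comm]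
  refine sum_congr rfl fun x₂ _ => ?_
  rw [← mul_sum]
  simp [filter_eq']

end Encoding

/-! ### Performance of a codebook averaged over messages. -/

section MeanPerformance

variable {ι : Type*} [Fintype ι] [DecidableEq ι] {T : ι → Type*} [∀ i, Fintype (T i)]
  {Y : Type*} [Fintype Y] {α β : ι → Type*} [∀ i, Fintype (α i)] [∀ i, Fintype (β i)]
  [∀ i, DecidableEq (α i)] [∀ i, DecidableEq (β i)] {μ : Type*} [Fintype μ]

open scoped Classical in
/-- The error probability of threshold decoding, averaged over the messages and the
randomization. -/
noncomputable def meanError (p : ∀ i, T i → ℝ) (V : (∀ i, T i) → Y → ℝ) (D E : Finset ι)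
    (γ : Finset ι → ℝ) (msg : μ → ∀ i, α i) (B : ∀ i, α i × β i → T i) : ℝ :=
  (Fintype.card μ : ℝ)⁻¹ * ∑ w, (∏ i, (Fintype.card (β i) : ℝ))⁻¹ * ∑ b : ∀ i, β i,
    ∑ y, V (codeword B fun i => (msg w i, b i)) y *
      (if DecodingError p V D E γ B (fun i => (msg w i, b i)) y then 1 else 0)

/-- The divergence of the induced output law from the output law of independent inputs, averaged
over the messages. -/
noncomputable def meanDivergence (p : ∀ i, T i → ℝ) (V : (∀ i, T i) → Y → ℝ)
    (msg : μ → ∀ i, α i) (B : ∀ i, α i × β i → T i) : ℝ :=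
  (Fintype.card μ : ℝ)⁻¹ * ∑ w, ∑ y, inducedLaw V B (msg w) y *
    Real.log (inducedLaw V B (msg w) y / ∑ t, prodLaw p t * V t y)

lemma inv_card_mul_sum_le {κ : Type*} [Fintype κ] [Nonempty κ] {x : κ → ℝ} {c : ℝ}
    (h : ∀ k, x k ≤ c) : (Fintype.card κ : ℝ)⁻¹ * ∑ k, x k ≤ c := by
  rw [inv_mul_le_iff₀ (Nat.cast_pos.2 Fintype.card_pos), ← nsmul_eq_mul, ← card_univ]
  exact sum_le_card_nsmul _ _ _ fun k _ => h k

lemma inducedLaw_nonneg {V : (∀ i, T i) → Y → ℝ} (hV0 : ∀ t y, 0 ≤ V t y)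
    (B : ∀ i, α i × β i → T i) (a : ∀ i, α i) (y : Y) : 0 ≤ inducedLaw V B a y :=
  mul_nonneg (inv_nonneg.2 (prod_nonneg fun _ _ => Nat.cast_nonneg _))
    (sum_nonneg fun _ _ => hV0 _ _)

lemma sum_inducedLaw [∀ i, Nonempty (β i)] {V : (∀ i, T i) → Y → ℝ} (hV : ∀ t, ∑ y, V t y = 1)
    (B : ∀ i, α i × β i → T i) (a : ∀ i, α i) : ∑ y, inducedLaw V B a y = 1 := by
  have : (∏ i, (Fintype.card (β i) : ℝ)) ≠ 0 :=
    prod_ne_zero_iff.2 fun i _ => Nat.cast_ne_zero.2 Fintype.card_ne_zero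
  simp only [inducedLaw]
  rw [← mul_sum, sum_comm]
  simp [hV, Fintype.card_pi, this]

/-- Every codeword tuple of a codebook of positive probability lies in the support of the input law.
This is the absolute continuity required by the divergence estimates. -/
lemma outputLaw_pos_of_inducedLaw_pos {p : ∀ i, T i → ℝ} (hp0 : ∀ i t, 0 ≤ p i t)
    {V : (∀ i, T i) → Y → ℝ} (hV0 : ∀ t y, 0 ≤ V t y) {B : ∀ i, α i × β i → T i}
    (hB : 0 < codebookLaw p B) {a : ∀ i, α i} {y : Y} (h : 0 < inducedLaw V B a y) :
    0 < ∑ t, prodLaw p t * V t y := by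
  have : ∃ b : ∀ i, β i, 0 < V (codeword B fun i => (a i, b i)) y := by
    by_contra! hcon
    have : ∀ b : ∀ i, β i, V (codeword B fun i => (a i, b i)) y = 0 := fun b =>
      le_antisymm (hcon b) (hV0 _ _)
    simp [inducedLaw, this] at h
  obtain ⟨b, hb⟩ := this
  exact sum_pos' (fun t _ => mul_nonneg (prodLaw_nonneg hp0 t) (hV0 t y))
    ⟨_, mem_univ _, mul_pos (prodLaw_codeword_pos hp0 hB _) hb⟩

lemma sum_outputLaw {p : ∀ i, T i → ℝ} (hp : ∀ i, ∑ t, p i t = 1) {V : (∀ i, T i) → Y → ℝ}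
    (hV : ∀ t, ∑ y, V t y = 1) : ∑ y, ∑ t, prodLaw p t * V t y = 1 := by
  rw [sum_comm]
  simp_rw [← mul_sum, hV, mul_one, sum_prodLaw hp]

lemma meanError_nonneg {p : ∀ i, T i → ℝ} {V : (∀ i, T i) → Y → ℝ} (hV0 : ∀ t y, 0 ≤ V t y)
    (D E : Finset ι) (γ : Finset ι → ℝ) (msg : μ → ∀ i, α i) (B : ∀ i, α i × β i → T i) :
    0 ≤ meanError p V D E γ msg B := by
  refine mul_nonneg (by positivity) (sum_nonneg fun w _ => mul_nonneg (by positivity)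
    (sum_nonneg fun b _ => sum_nonneg fun y _ => mul_nonneg (hV0 _ _) ?_))
  split_ifs <;> norm_num

lemma meanDivergence_nonneg [∀ i, Nonempty (β i)] {p : ∀ i, T i → ℝ} (hp0 : ∀ i t, 0 ≤ p i t)
    (hp : ∀ i, ∑ t, p i t = 1) {V : (∀ i, T i) → Y → ℝ} (hV0 : ∀ t y, 0 ≤ V t y)
    (hV : ∀ t, ∑ y, V t y = 1) (msg : μ → ∀ i, α i) {B : ∀ i, α i × β i → T i}
    (hB : 0 < codebookLaw p B) : 0 ≤ meanDivergence p V msg B := by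
  refine mul_nonneg (by positivity) (sum_nonneg fun w _ => ?_)
  refine gibbs_inequality (inducedLaw_nonneg hV0 B _)
    (fun y => sum_nonneg fun t _ => mul_nonneg (prodLaw_nonneg hp0 t) (hV0 t y))
    (fun y hy => outputLaw_pos_of_inducedLaw_pos hp0 hV0 hB hy) ?_
  rw [sum_outputLaw hp hV, sum_inducedLaw hV]

lemma sum_codebookLaw_meanDivergence_le [Nonempty μ] [∀ i, Nonempty (β i)] {p : ∀ i, T i → ℝ}
    (hp0 : ∀ i t, 0 ≤ p i t) (hp : ∀ i, ∑ t, p i t = 1) {V : (∀ i, T i) → Y → ℝ}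
    (hV0 : ∀ t y, 0 ≤ V t y) (msg : μ → ∀ i, α i) :
    ∑ B : ∀ i, α i × β i → T i, codebookLaw p B * meanDivergence p V msg B ≤
    ∑ t, prodLaw p t * ∑ y, V t y *
      Real.log (softCovering p V (fun i => Fintype.card (β i)) t y) := by
  classical
  have h := inv_card_mul_sum_le fun w : μ =>
    sum_codebookLaw_divergence_le (β := β) hp0 hp hV0 (msg w)
  rw [sum_comm, mul_sum] at h
  refine le_trans (le_of_eq (sum_congr rfl fun B _ => ?_)) h
  rw [← mul_sum, meanDivergence]
  ring

open scoped Classical in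
lemma sum_codebookLaw_meanError_le [Nonempty μ] [∀ i, Nonempty (β i)] {p : ∀ i, T i → ℝ}
    (hp0 : ∀ i t, 0 ≤ p i t) (hp : ∀ i, ∑ t, p i t = 1) {V : (∀ i, T i) → Y → ℝ}
    (hV0 : ∀ t y, 0 ≤ V t y) (hV : ∀ t, ∑ y, V t y = 1) {D E : Finset ι} (hED : E ⊆ D)
    (γ : Finset ι → ℝ) (msg : μ → ∀ i, α i) :
    ∑ B : ∀ i, α i × β i → T i, codebookLaw p B * meanError p V D E γ msg B ≤
    ∑ t, prodLaw p t * ∑ y, V t y * (if DecodingTest p V D E γ t y then 0 else 1) +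
      ∑ S ∈ D.powerset with (S ∩ E).Nonempty,
        (∏ i ∈ S, (Fintype.card (α i × β i) : ℝ)) * Real.exp (-γ S) := by
  have h := inv_card_mul_sum_le fun w : μ => inv_card_mul_sum_le fun b : ∀ i, β i =>
    sum_codebookLaw_decodingError_le (K := fun i => α i × β i) hp0 hp hV0 hV hED γ
      (fun i => (msg w i, b i))
  refine le_trans (le_of_eq ?_) h
  simp only [meanError, Fintype.card_pi, Nat.cast_prod, mul_sum]
  rw [sum_comm]
  refine sum_congr rfl fun w _ => ?_
  rw [sum_comm]
  refine sum_congr rfl fun b _ => sum_congr rfl fun B _ => sum_congr rfl fun y _ => ?_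
  ring

/-- The positive weight is essential to the use made of this: only for codebooks in the support is
the divergence known to be nonnegative and to bound the leakage. -/
lemma exists_pos_and_le_of_sum_mul_le {κ : Type*} [Fintype κ] {w F : κ → ℝ} {c : ℝ}
    (hw0 : ∀ k, 0 ≤ w k) (hw : ∑ k, w k = 1) (h : ∑ k, w k * F k ≤ c) :
    ∃ k, 0 < w k ∧ F k ≤ c := by
  by_contra! hcon
  have h1 : ∑ k, w k * c < ∑ k, w k * F k := by
    refine sum_lt_sum (fun k _ => ?_) ?_
    · rcases (hw0 k).eq_or_lt with h0 | h0
      · simp [← h0]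
      · exact mul_le_mul_of_nonneg_left (hcon k h0).le h0.le
    · obtain ⟨k, -, hk⟩ : ∃ k ∈ univ, 0 < w k := by
        by_contra! hno
        have : ∑ k, w k ≤ 0 := sum_nonpos fun k hk => hno k hk
        linarith
      exact ⟨k, mem_univ k, mul_lt_mul_of_pos_left (hcon k hk) hk⟩
  rw [← sum_mul, hw, one_mul] at h1
  linarith

end MeanPerformance

/-! ### A secret code from a codebook. -/

section Code

variable {𝒳₁ 𝒳₂ 𝒴₁ 𝒴₂ 𝒴ₑ : Type*} [Fintype 𝒳₁] [Fintype 𝒳₂]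
  [Fintype 𝒴₁] [Fintype 𝒴₂] [Fintype 𝒴ₑ] {𝒬 : Type} [Fintype 𝒬]
  {𝒯 : Aux → Type} [∀ i, Fintype (𝒯 i)]
  (W : Channel 𝒳₁ 𝒳₂ 𝒴₁ 𝒴₂ 𝒴ₑ) (pX₁ : 𝒯 .C₁ → 𝒯 .S₁ → 𝒯 .O₁ → 𝒬 → stdSimplex ℝ 𝒳₁)
  (pX₂ : 𝒯 .C₂ → 𝒯 .S₂ → 𝒯 .O₂ → 𝒬 → stdSimplex ℝ 𝒳₂)
  (pQ : stdSimplex ℝ 𝒬) (pT : ∀ i, 𝒬 → stdSimplex ℝ (𝒯 i))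
  {n : ℕ} {α β : Aux → Type} [∀ i, Fintype (α i)] [∀ i, Fintype (β i)]
  [∀ i, DecidableEq (α i)] [∀ i, DecidableEq (β i)] [∀ i, Nonempty (β i)] {M₁ M₂ : ℕ} [NeZero M₁] [NeZero M₂]

open scoped Classical in
/-- The decoder that outputs a message with a label that passes the test. -/
noncomputable def thresholdDecoder {κ μ Y : Type*} [Nonempty μ] (label : κ → μ → Prop)
    (test : κ → Y → Prop) (y : Y) : μ :=
  if h : ∃ w, ∃ k, label k w ∧ test k y then h.choose else Classical.arbitrary μ

lemma thresholdDecoder_spec {κ μ Y : Type*} [Nonempty μ] {label : κ → μ → Prop}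
    {test : κ → Y → Prop} {y : Y} {w : μ} {k : κ} (hk : label k w) (ht : test k y) :
    ∃ k', label k' (thresholdDecoder label test y) ∧ test k' y := by
  have h : ∃ w, ∃ k, label k w ∧ test k y := ⟨w, k, hk, ht⟩
  rw [thresholdDecoder, dif_pos h]
  exact h.choose_spec

/-- The secret code of a codebook. The message parts of the indices are given by `a₁`, `a₂`, and the
decoders recover the layers in `E₁`, `E₂`. -/
noncomputable def codebookCode (q : Fin n → 𝒬) (B : ∀ i, α i × β i → Fin n → 𝒯 i)
    (a₁ : Fin M₁ → ∀ i, α i) (a₂ : Fin M₂ → ∀ i, α i) (D₁ D₂ E₁ E₂ : Finset Aux)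
    (γ₁ γ₂ : Finset Aux → ℝ) : SecretCode 𝒳₁ 𝒳₂ 𝒴₁ 𝒴₂ n M₁ M₂ where
  enc₁ w := encoder₁ pX₁ q B (a₁ w)
  enc₂ w := encoder₂ pX₂ q B (a₂ w)
  dec₁ := thresholdDecoder (fun k w => ∀ i ∈ E₁, (k i).1 = a₁ w i) fun k y =>
    DecodingTest (blockLaw pT q) (blockChannel (layerChannel W pX₁ pX₂ fun y => y.1) q) D₁ E₁ γ₁
      (codeword B k) y
  dec₂ := thresholdDecoder (fun k w => ∀ i ∈ E₂, (k i).1 = a₂ w i) fun k y =>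
    DecodingTest (blockLaw pT q) (blockChannel (layerChannel W pX₁ pX₂ fun y => y.2.1) q) D₂ E₂ γ₂
      (codeword B k) y

variable (q : Fin n → 𝒬) (B : ∀ i, α i × β i → Fin n → 𝒯 i)
    (a₁ : Fin M₁ → ∀ i, α i) (a₂ : Fin M₂ → ∀ i, α i) (D₁ D₂ E₁ E₂ : Finset Aux)
    (γ₁ γ₂ : Finset Aux → ℝ)

lemma sum_outputLaw_codebookCode {𝒴 : Type*} [Fintype 𝒴] (Y : 𝒴₁ × 𝒴₂ × 𝒴ₑ → 𝒴)
    (F : (Fin n → 𝒴) → ℝ) (w₁ : Fin M₁) (w₂ : Fin M₂) :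
    ∑ y, (codebookCode W pX₁ pX₂ pT q B a₁ a₂ D₁ D₂ E₁ E₂ γ₁ γ₂).outputLaw W w₁ w₂ y *
      F (fun j => Y (y.1 j, y.2.1 j, y.2.2 j)) =
    ∑ z, inducedLaw (blockChannel (layerChannel W pX₁ pX₂ Y) q) B
      (firstLayers.piecewise (a₁ w₁) (a₂ w₂)) z * F z := by
  let e : (Fin n → 𝒴₁ × 𝒴₂ × 𝒴ₑ) ≃ (Fin n → 𝒴₁) × (Fin n → 𝒴₂) × (Fin n → 𝒴ₑ) :=
    { toFun := fun y => (fun j => (y j).1, fun j => (y j).2.1, fun j => (y j).2.2)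
      invFun := fun y j => (y.1 j, y.2.1 j, y.2.2 j)
      left_inv := fun _ => rfl
      right_inv := fun _ => rfl }
  rw [← sum_inducedLaw_mul_comp, ← e.sum_comp]
  refine sum_congr rfl fun y _ => ?_
  rw [← sum_encoder_mul]
  rfl

-- If the transmitted tuple passes, the decoder returns the label of some passing tuple. If that
-- tuple agreed with the true one on `E`, injectivity of the labels would make the message correct,
-- so every mistake is a `DecodingError`.
open scoped Classical in
lemma sum_not_decoded_le {𝒴 : Type*} [Fintype 𝒴] {V : (∀ i, Fin n → 𝒯 i) → 𝒴 → ℝ}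
    (hV0 : ∀ t y, 0 ≤ V t y) (p : ∀ i, (Fin n → 𝒯 i) → ℝ) {M : ℕ} [NeZero M]
    (a : Fin M → ∀ i, α i) {D E : Finset Aux} {γ : Finset Aux → ℝ}
    (ha : ∀ w w', (∀ i ∈ E, a w i = a w' i) → w = w') (w : Fin M) (m : ∀ i, α i)
    (hm : ∀ i ∈ E, m i = a w i) :
    ∑ z, inducedLaw V B m z * (if thresholdDecoder
      (fun (k : ∀ i, α i × β i) (w : Fin M) => ∀ i ∈ E, (k i).1 = a w i)
      (fun k y => DecodingTest p V D E γ (codeword B k) y) z ≠ w then 1 else 0) ≤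
    (∏ i, (Fintype.card (β i) : ℝ))⁻¹ * ∑ b : ∀ i, β i,
      ∑ y, V (codeword B fun i => (m i, b i)) y *
        (if DecodingError p V D E γ B (fun i => (m i, b i)) y then 1 else 0) := by
  simp only [inducedLaw, mul_assoc, sum_mul, ← mul_sum]
  refine mul_le_mul_of_nonneg_left ?_ (by positivity)
  rw [sum_comm]
  refine sum_le_sum fun b _ => sum_le_sum fun z _ => mul_le_mul_of_nonneg_left ?_ (hV0 _ _)
  split_ifs with h1 h2 h2
  · exact le_rfl
  · refine absurd ?_ h2
    by_cases ht : DecodingTest p V D E γ (codeword B fun i => (m i, b i)) z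
    · right
      obtain ⟨k', hk', ht'⟩ := thresholdDecoder_spec
        (label := fun (k : ∀ i, α i × β i) (w : Fin M) => ∀ i ∈ E, (k i).1 = a w i)
        (test := fun k y => DecodingTest p V D E γ (codeword B k) y) (w := w)
        (k := fun i => (m i, b i)) hm ht
      refine ⟨k', ?_, ht'⟩
      by_contra! hcon
      refine h1 (ha _ _ fun i hi => ?_)
      rw [← hk' i hi, hcon i hi, hm i hi]
    · exact Or.inl ht
  · norm_num
  · exact le_rfl

/-- The message parts of the indices as a function of the message pair. -/
def messageIndex (a₁ : Fin M₁ → ∀ i, α i) (a₂ : Fin M₂ → ∀ i, α i) (w : Fin M₁ × Fin M₂) :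
    ∀ i, α i := firstLayers.piecewise (a₁ w.1) (a₂ w.2)

lemma errorProb₁_codebookCode_le (hE : E₁ ⊆ firstLayers)
    (ha : ∀ w w', (∀ i ∈ E₁, a₁ w i = a₁ w' i) → w = w') :
    (codebookCode W pX₁ pX₂ pT q B a₁ a₂ D₁ D₂ E₁ E₂ γ₁ γ₂).errorProb₁ W ≤
      meanError (blockLaw pT q) (blockChannel (layerChannel W pX₁ pX₂ fun y => y.1) q) D₁ E₁ γ₁
        (messageIndex a₁ a₂) B := by
  classical
  rw [SecretCode.errorProb₁, meanError, Fintype.sum_prod_type, Fintype.card_prod, Fintype.card_fin,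
    Fintype.card_fin, one_div, Nat.cast_mul]
  refine mul_le_mul_of_nonneg_left (sum_le_sum fun w₁ _ => sum_le_sum fun w₂ _ => ?_)
    (by positivity)
  refine le_trans (le_of_eq ?_) (sum_not_decoded_le B (blockChannel_nonneg _ q) (blockLaw pT q)
    a₁ ha w₁ _ fun i hi => by simp [messageIndex, hE hi])
  rw [messageIndex, ← sum_outputLaw_codebookCode W pX₁ pX₂ pT q B a₁ a₂ D₁ D₂ E₁ E₂ γ₁ γ₂
    (fun y => y.1), sum_filter]
  refine sum_congr rfl fun y _ => ?_
  simp only [mul_ite, mul_one, mul_zero]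
  rfl

lemma errorProb₂_codebookCode_le (hE : Disjoint E₂ firstLayers)
    (ha : ∀ w w', (∀ i ∈ E₂, a₂ w i = a₂ w' i) → w = w') :
    (codebookCode W pX₁ pX₂ pT q B a₁ a₂ D₁ D₂ E₁ E₂ γ₁ γ₂).errorProb₂ W ≤
      meanError (blockLaw pT q) (blockChannel (layerChannel W pX₁ pX₂ fun y => y.2.1) q) D₂ E₂ γ₂
        (messageIndex a₁ a₂) B := by
  classical
  rw [SecretCode.errorProb₂, meanError, Fintype.sum_prod_type, Fintype.card_prod, Fintype.card_fin,
    Fintype.card_fin, one_div, Nat.cast_mul]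
  refine mul_le_mul_of_nonneg_left (sum_le_sum fun w₁ _ => sum_le_sum fun w₂ _ => ?_)
    (by positivity)
  refine le_trans (le_of_eq ?_) (sum_not_decoded_le B (blockChannel_nonneg _ q) (blockLaw pT q)
    a₂ ha w₂ _ fun i hi => by simp [messageIndex, disjoint_left.1 hE hi])
  rw [messageIndex, ← sum_outputLaw_codebookCode W pX₁ pX₂ pT q B a₁ a₂ D₁ D₂ E₁ E₂ γ₁ γ₂
    (fun y => y.2.1), sum_filter]
  refine sum_congr rfl fun y _ => ?_
  simp only [mul_ite, mul_one, mul_zero]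
  rfl

/-- The reference law at the eavesdropper is the output law of independent inputs. It does not
depend on the messages, so closeness to it means that the output reveals little. -/
lemma le_equivocation_codebookCode {B : ∀ i, α i × β i → Fin n → 𝒯 i}
    (hB : 0 < codebookLaw (blockLaw pT q) B) :
    Real.log (M₁ * M₂) - meanDivergence (blockLaw pT q)
      (blockChannel (layerChannel W pX₁ pX₂ fun y => y.2.2) q) (messageIndex a₁ a₂) B ≤
    (codebookCode W pX₁ pX₂ pT q B a₁ a₂ D₁ D₂ E₁ E₂ γ₁ γ₂).equivocation W * Real.log 2 := by
  classical
  set V := blockChannel (layerChannel W pX₁ pX₂ fun y => y.2.2) q with hV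
  set c := codebookCode W pX₁ pX₂ pT q B a₁ a₂ D₁ D₂ E₁ E₂ γ₁ γ₂ with hc
  have hp0 := blockLaw_nonneg pT q
  have h := le_condEntropy_of_divergence (p := c.jointLaw W) (f := fun ω => ω.1)
    (g := fun ω => ω.2.2.2) (P := fun w => inducedLaw V B (messageIndex a₁ a₂ w))
    (Q := fun y => ∑ t, prodLaw (blockLaw pT q) t * V t y) ?_
    (fun w => inducedLaw_nonneg (blockChannel_nonneg _ q) B _)
    (fun w => sum_inducedLaw (sum_blockChannel _ q) B _)
    (fun y => sum_nonneg fun t _ => mul_nonneg (prodLaw_nonneg hp0 t) (blockChannel_nonneg _ q t y))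
    (sum_outputLaw (sum_blockLaw pT q) (sum_blockChannel _ q)).le
    (fun w y hy => outputLaw_pos_of_inducedLaw_pos hp0 (blockChannel_nonneg _ q) hB hy)
  · simpa [meanDivergence, SecretCode.equivocation] using h
  · rintro ⟨w₁, w₂⟩ z
    have h1 := sum_outputLaw_codebookCode W pX₁ pX₂ pT q B a₁ a₂ D₁ D₂ E₁ E₂ γ₁ γ₂
      (fun y => y.2.2) (fun z' => if z' = z then 1 else 0) w₁ w₂
    simp only [mul_ite, mul_one, mul_zero, sum_ite_eq', mem_univ, if_true] at h1
    rw [messageIndex, ← h1, marginal, sum_filter, Fintype.sum_prod_type, sum_eq_single (w₁, w₂),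
      mul_sum]
    · refine sum_congr rfl fun y _ => ?_
      simp only [Prod.mk.injEq, true_and, SecretCode.jointLaw, Fintype.card_prod, Fintype.card_fin]
      split_ifs <;> simp_all
    · intro w _ hw; simp [hw]
    · simp

open scoped Classical in
/-- Existence of a good code by averaging over the time sharing sequence and the codebook. -/
theorem exists_secretCode (a₁ : Fin M₁ → ∀ i, α i) (a₂ : Fin M₂ → ∀ i, α i)
    {D₁ D₂ E₁ E₂ : Finset Aux} (hED₁ : E₁ ⊆ D₁) (hED₂ : E₂ ⊆ D₂) (hE₁ : E₁ ⊆ firstLayers)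
    (hE₂ : Disjoint E₂ firstLayers)
    (ha₁ : ∀ w w', (∀ i ∈ E₁, a₁ w i = a₁ w' i) → w = w')
    (ha₂ : ∀ w w', (∀ i ∈ E₂, a₂ w i = a₂ w' i) → w = w')
    (γ₁ γ₂ : Finset Aux → ℝ) {e₁ e₂ s₁ s₂ l : ℝ}
    (he₁ : ∑ q : Fin n → 𝒬, (∏ j, pQ (q j)) * ∑ t, prodLaw (blockLaw pT q) t *
      ∑ y, blockChannel (layerChannel W pX₁ pX₂ fun y => y.1) q t y *
        (if DecodingTest (blockLaw pT q) (blockChannel (layerChannel W pX₁ pX₂ fun y => y.1) q)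
          D₁ E₁ γ₁ t y then 0 else 1) ≤ e₁)
    (he₂ : ∑ q : Fin n → 𝒬, (∏ j, pQ (q j)) * ∑ t, prodLaw (blockLaw pT q) t *
      ∑ y, blockChannel (layerChannel W pX₁ pX₂ fun y => y.2.1) q t y *
        (if DecodingTest (blockLaw pT q) (blockChannel (layerChannel W pX₁ pX₂ fun y => y.2.1) q)
          D₂ E₂ γ₂ t y then 0 else 1) ≤ e₂)
    (hs₁ : ∑ S ∈ D₁.powerset with (S ∩ E₁).Nonempty,
        (∏ i ∈ S, (Fintype.card (α i × β i) : ℝ)) * Real.exp (-γ₁ S) ≤ s₁)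
    (hs₂ : ∑ S ∈ D₂.powerset with (S ∩ E₂).Nonempty,
        (∏ i ∈ S, (Fintype.card (α i × β i) : ℝ)) * Real.exp (-γ₂ S) ≤ s₂)
    (hl : ∑ q : Fin n → 𝒬, (∏ j, pQ (q j)) * ∑ t, prodLaw (blockLaw pT q) t *
      ∑ y, blockChannel (layerChannel W pX₁ pX₂ fun y => y.2.2) q t y *
        Real.log (softCovering (blockLaw pT q)
          (blockChannel (layerChannel W pX₁ pX₂ fun y => y.2.2) q)
          (fun i => Fintype.card (β i)) t y) ≤ l) {κ : ℝ} (hκ : 0 < κ) :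
    ∃ c : SecretCode 𝒳₁ 𝒳₂ 𝒴₁ 𝒴₂ n M₁ M₂,
      c.errorProb₁ W ≤ (e₁ + s₁) + (e₂ + s₂) + κ * l ∧
      c.errorProb₂ W ≤ (e₁ + s₁) + (e₂ + s₂) + κ * l ∧
      κ * (Real.log (M₁ * M₂) - c.equivocation W * Real.log 2) ≤
        (e₁ + s₁) + (e₂ + s₂) + κ * l := by
  let V₁ := fun q : Fin n → 𝒬 => blockChannel (layerChannel W pX₁ pX₂ fun y => y.1) q
  let V₂ := fun q : Fin n → 𝒬 => blockChannel (layerChannel W pX₁ pX₂ fun y => y.2.1) q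
  let Vₑ := fun q : Fin n → 𝒬 => blockChannel (layerChannel W pX₁ pX₂ fun y => y.2.2) q
  let m := messageIndex a₁ a₂
  have hq0 : ∀ q : Fin n → 𝒬, 0 ≤ ∏ j, pQ (q j) := fun q =>
    prod_nonneg fun _ _ => stdSimplex.zero_le _ _
  have hq1 : ∑ q : Fin n → 𝒬, ∏ j, pQ (q j) = 1 := sum_prod_law (stdSimplex.sum_eq_one pQ) n
  have b₁ : ∑ q : Fin n → 𝒬, (∏ j, pQ (q j)) * ∑ B : ∀ i, α i × β i → Fin n → 𝒯 i,
      codebookLaw (blockLaw pT q) B * meanError (blockLaw pT q) (V₁ q) D₁ E₁ γ₁ m B ≤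
      e₁ + s₁ := by
    refine (sum_le_sum fun q _ => mul_le_mul_of_nonneg_left (sum_codebookLaw_meanError_le
      (blockLaw_nonneg pT q) (sum_blockLaw pT q) (blockChannel_nonneg _ q) (sum_blockChannel _ q)
      hED₁ γ₁ m) (hq0 q)).trans ?_
    simp_rw [mul_add, sum_add_distrib]
    rw [← sum_mul, hq1, one_mul]
    exact add_le_add he₁ hs₁
  have b₂ : ∑ q : Fin n → 𝒬, (∏ j, pQ (q j)) * ∑ B : ∀ i, α i × β i → Fin n → 𝒯 i,
      codebookLaw (blockLaw pT q) B * meanError (blockLaw pT q) (V₂ q) D₂ E₂ γ₂ m B ≤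
      e₂ + s₂ := by
    refine (sum_le_sum fun q _ => mul_le_mul_of_nonneg_left (sum_codebookLaw_meanError_le
      (blockLaw_nonneg pT q) (sum_blockLaw pT q) (blockChannel_nonneg _ q) (sum_blockChannel _ q)
      hED₂ γ₂ m) (hq0 q)).trans ?_
    simp_rw [mul_add, sum_add_distrib]
    rw [← sum_mul, hq1, one_mul]
    exact add_le_add he₂ hs₂
  have b₃ : ∑ q : Fin n → 𝒬, (∏ j, pQ (q j)) * ∑ B : ∀ i, α i × β i → Fin n → 𝒯 i,
      codebookLaw (blockLaw pT q) B * meanDivergence (blockLaw pT q) (Vₑ q) m B ≤ l :=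
    (sum_le_sum fun q _ => mul_le_mul_of_nonneg_left (sum_codebookLaw_meanDivergence_le
      (blockLaw_nonneg pT q) (sum_blockLaw pT q) (blockChannel_nonneg _ q) m) (hq0 q)).trans hl
  -- Averaging the sum of the three criteria gives one time sharing sequence and one codebook. Since
  -- each summand is nonnegative, each is bounded by the total.
  have hF := exists_pos_and_le_of_sum_mul_le
    (κ := (Fin n → 𝒬) × (∀ i, α i × β i → Fin n → 𝒯 i))
    (w := fun x => (∏ j, pQ (x.1 j)) * codebookLaw (blockLaw pT x.1) x.2)
    (F := fun x => meanError (blockLaw pT x.1) (V₁ x.1) D₁ E₁ γ₁ m x.2 +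
      meanError (blockLaw pT x.1) (V₂ x.1) D₂ E₂ γ₂ m x.2 +
      κ * meanDivergence (blockLaw pT x.1) (Vₑ x.1) m x.2)
    (c := (e₁ + s₁) + (e₂ + s₂) + κ * l)
    (fun x => mul_nonneg (hq0 _) (codebookLaw_nonneg (blockLaw_nonneg pT _) _)) ?_ ?_
  · obtain ⟨⟨q, B⟩, hpos, hle⟩ := hF
    have hB : 0 < codebookLaw (blockLaw pT q) B := by
      refine (codebookLaw_nonneg (blockLaw_nonneg pT q) B).lt_of_ne' fun h0 => ?_
      simp [h0] at hpos
    have n₁ : 0 ≤ meanError (blockLaw pT q) (V₁ q) D₁ E₁ γ₁ m B :=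
      meanError_nonneg (blockChannel_nonneg _ q) _ _ _ _ _
    have n₂ : 0 ≤ meanError (blockLaw pT q) (V₂ q) D₂ E₂ γ₂ m B :=
      meanError_nonneg (blockChannel_nonneg _ q) _ _ _ _ _
    have n₃ : 0 ≤ κ * meanDivergence (blockLaw pT q) (Vₑ q) m B :=
      mul_nonneg hκ.le (meanDivergence_nonneg (blockLaw_nonneg pT q) (sum_blockLaw pT q)
        (blockChannel_nonneg _ q) (sum_blockChannel _ q) m hB)
    have c₁ : _ ≤ meanError (blockLaw pT q) (V₁ q) D₁ E₁ γ₁ m B :=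
      errorProb₁_codebookCode_le W pX₁ pX₂ pT q B a₁ a₂ D₁ D₂ E₁ E₂ γ₁ γ₂ hE₁ ha₁
    have c₂ : _ ≤ meanError (blockLaw pT q) (V₂ q) D₂ E₂ γ₂ m B :=
      errorProb₂_codebookCode_le W pX₁ pX₂ pT q B a₁ a₂ D₁ D₂ E₁ E₂ γ₁ γ₂ hE₂ ha₂
    have c₃ : κ * (_ - meanDivergence (blockLaw pT q) (Vₑ q) m B) ≤ _ := mul_le_mul_of_nonneg_left (le_equivocation_codebookCode W pX₁ pX₂ pT q a₁ a₂
      D₁ D₂ E₁ E₂ γ₁ γ₂ hB) hκ.le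
    refine ⟨codebookCode W pX₁ pX₂ pT q B a₁ a₂ D₁ D₂ E₁ E₂ γ₁ γ₂, ?_, ?_, ?_⟩
    · linarith
    · linarith
    · linarith
  · rw [Fintype.sum_prod_type]
    simp_rw [← mul_sum, sum_codebookLaw (sum_blockLaw pT _), mul_one, hq1]
  · rw [Fintype.sum_prod_type]
    refine le_trans (le_of_eq ?_) (add_le_add (add_le_add b₁ b₂)
      (mul_le_mul_of_nonneg_left b₃ hκ.le))
    simp only [mul_sum, ← sum_add_distrib]
    exact sum_congr rfl fun q _ => sum_congr rfl fun B _ => by ring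

end Code

/-! ### Rounding of message set sizes and exponential error decay. -/

section Achievability

lemma le_ceil_two_rpow {n : ℕ} (r : ℝ) :
    Real.exp (n * (r * Real.log 2)) ≤ (⌈(2 : ℝ) ^ ((n : ℝ) * r)⌉₊ : ℝ) := by
  refine le_trans (le_of_eq ?_) (Nat.le_ceil _)
  rw [Real.rpow_def_of_pos two_pos]
  congr 1; ring

lemma ceil_two_rpow_le {n : ℕ} {r : ℝ} (hr : 0 ≤ r) :
    (⌈(2 : ℝ) ^ ((n : ℝ) * r)⌉₊ : ℝ) ≤ 2 * Real.exp (n * (r * Real.log 2)) := by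
  have h : (2 : ℝ) ^ ((n : ℝ) * r) = Real.exp (n * (r * Real.log 2)) := by
    rw [Real.rpow_def_of_pos two_pos]
    congr 1; ring
  rw [h]
  have h1 : 1 ≤ Real.exp (n * (r * Real.log 2)) :=
    Real.one_le_exp (mul_nonneg (Nat.cast_nonneg n)
      (mul_nonneg hr (Real.log_pos one_lt_two).le))
  have := (Nat.ceil_lt_add_one (Real.exp_pos (n * (r * Real.log 2))).le).le
  linarith

lemma ceil_two_rpow_pos (n : ℕ) (r : ℝ) : 0 < ⌈(2 : ℝ) ^ ((n : ℝ) * r)⌉₊ :=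
  Nat.ceil_pos.2 (Real.rpow_pos_of_pos two_pos _)

lemma ceil_two_rpow_add_le (n : ℕ) (r s : ℝ) : ⌈(2 : ℝ) ^ ((n : ℝ) * (r + s))⌉₊ ≤
    ⌈(2 : ℝ) ^ ((n : ℝ) * r)⌉₊ * ⌈(2 : ℝ) ^ ((n : ℝ) * s)⌉₊ := by
  rw [Nat.ceil_le, mul_add, Real.rpow_add two_pos, Nat.cast_mul]
  exact mul_le_mul (Nat.le_ceil _) (Nat.le_ceil _) (Real.rpow_nonneg two_pos.le _)
    (Nat.cast_nonneg _)

/-- A message set is embedded into the message parts of two layers; layers of rate zero carry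
nothing. -/
lemma exists_messageIndex (n : ℕ) (r : Aux → ℝ) {u v : Aux} (huv : u ≠ v)
    (hr : ∀ i, 0 ≤ r i) :
    ∃ a : Fin ⌈(2 : ℝ) ^ ((n : ℝ) * (r u + r v))⌉₊ → ∀ i, Fin ⌈(2 : ℝ) ^ ((n : ℝ) * r i)⌉₊,
      ∀ w w', (∀ i ∈ ({u, v} : Finset Aux).filter (0 < r ·), a w i = a w' i) → w = w' := by
  obtain ⟨e⟩ : Nonempty (Fin ⌈(2 : ℝ) ^ ((n : ℝ) * (r u + r v))⌉₊ ↪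
      Fin ⌈(2 : ℝ) ^ ((n : ℝ) * r u)⌉₊ × Fin ⌈(2 : ℝ) ^ ((n : ℝ) * r v)⌉₊) :=
    Function.Embedding.nonempty_of_card_le (by simpa using ceil_two_rpow_add_le n (r u) (r v))
  refine ⟨fun w => Function.update (Function.update
    (fun i => (⟨0, ceil_two_rpow_pos n (r i)⟩ : Fin ⌈(2 : ℝ) ^ ((n : ℝ) * r i)⌉₊)) u (e w).1)
    v (e w).2, fun w w' h => e.injective ?_⟩
  have key : ∀ i ∈ ({u, v} : Finset Aux), ∀ x y : Fin ⌈(2 : ℝ) ^ ((n : ℝ) * r i)⌉₊,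
      (0 < r i → x = y) → x = y := by
    intro i _ x y hxy
    rcases (hr i).eq_or_lt with h0 | h0
    -- A layer of rate zero has a single message index, so ignoring it loses no injectivity.
    · have h1 : ⌈(2 : ℝ) ^ ((n : ℝ) * r i)⌉₊ = 1 := by simp [← h0]
      ext
      have := x.2; have := y.2
      omega
    · exact hxy h0
  refine Prod.ext (key u (by simp) _ _ fun hu => ?_) (key v (by simp) _ _ fun hv => ?_)
  · have := h u (by simp [hu])
    simpa [Function.update_of_ne huv] using this
  · have := h v (by simp [hv])
    simpa using this

variable {ι : Type*} [Fintype ι] [DecidableEq ι] {𝒬 : Type*} [Fintype 𝒬] {𝒯 : ι → Type*}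
  [∀ i, Fintype (𝒯 i)] {𝒴 : Type*} [Fintype 𝒴]

/-- The union bound over the error patterns decays exponentially when the rates are below the
information rates. -/
lemma sum_errorPattern_le (pQ : stdSimplex ℝ 𝒬) (pT : ∀ i, 𝒬 → stdSimplex ℝ (𝒯 i))
    (V : 𝒬 → (∀ i, 𝒯 i) → stdSimplex ℝ 𝒴) {r rx : ι → ℝ} (hr : ∀ i, 0 ≤ r i)
    (hrx : ∀ i, 0 ≤ rx i) {η : ℝ} {D E : Finset ι}
    (h : ∀ S ⊆ D, (S ∩ E).Nonempty → (∑ i ∈ S, (r i + rx i)) * Real.log 2 + 3 * η ≤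
      logLikelihood pQ pT V D - logLikelihood pQ pT V (D \ S)) (n : ℕ) :
    ∑ S ∈ D.powerset with (S ∩ E).Nonempty,
      (∏ i ∈ S, (Fintype.card (Fin ⌈(2 : ℝ) ^ ((n : ℝ) * r i)⌉₊ ×
        Fin ⌈(2 : ℝ) ^ ((n : ℝ) * rx i)⌉₊) : ℝ)) *
        Real.exp (-decodingThreshold pQ pT V n η D S) ≤
    Fintype.card (Finset ι) * 4 ^ Fintype.card ι * Real.exp (-(n * η)) := by
  have hterm : ∀ S ∈ D.powerset.filter (fun S => (S ∩ E).Nonempty),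
      (∏ i ∈ S, (Fintype.card (Fin ⌈(2 : ℝ) ^ ((n : ℝ) * r i)⌉₊ ×
        Fin ⌈(2 : ℝ) ^ ((n : ℝ) * rx i)⌉₊) : ℝ)) *
        Real.exp (-decodingThreshold pQ pT V n η D S) ≤
      4 ^ Fintype.card ι * Real.exp (-(n * η)) := by
    intro S hS
    simp only [mem_filter, mem_powerset] at hS
    have h1 : ∏ i ∈ S, (Fintype.card (Fin ⌈(2 : ℝ) ^ ((n : ℝ) * r i)⌉₊ ×
        Fin ⌈(2 : ℝ) ^ ((n : ℝ) * rx i)⌉₊) : ℝ) ≤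
        ∏ i ∈ S, 4 * Real.exp (n * ((r i + rx i) * Real.log 2)) := by
      -- The `4` is one factor `2` for rounding up the message part and one for the randomization
      -- part.
      refine prod_le_prod (fun _ _ => Nat.cast_nonneg _) fun i _ => ?_
      rw [Fintype.card_prod, Fintype.card_fin, Fintype.card_fin, Nat.cast_mul]
      refine (mul_le_mul (ceil_two_rpow_le (hr i)) (ceil_two_rpow_le (hrx i))
        (Nat.cast_nonneg _) (by positivity)).trans (le_of_eq ?_)
      rw [add_mul, mul_add, Real.exp_add]; ring
    have h2 : ∏ i ∈ S, 4 * Real.exp (n * ((r i + rx i) * Real.log 2)) ≤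
        4 ^ Fintype.card ι * Real.exp (n * ((∑ i ∈ S, (r i + rx i)) * Real.log 2)) := by
      rw [prod_mul_distrib, prod_const, ← Real.exp_sum, ← mul_sum, ← sum_mul]
      refine mul_le_mul_of_nonneg_right ?_ (Real.exp_pos _).le
      exact pow_le_pow_right₀ (by norm_num) (card_le_univ S)
    refine (mul_le_mul_of_nonneg_right (h1.trans h2) (Real.exp_pos _).le).trans ?_
    rw [mul_assoc, ← Real.exp_add]
    refine mul_le_mul_of_nonneg_left (Real.exp_le_exp.2 ?_) (by positivity)
    have := mul_le_mul_of_nonneg_left (h S hS.1 hS.2) (Nat.cast_nonneg (α := ℝ) n)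
    -- Of the slack `3 * η`, the threshold uses `2 * η`; the remaining `η` is the error exponent.
    rw [decodingThreshold]
    linarith
  refine (sum_le_card_nsmul _ _ _ hterm).trans ?_
  rw [nsmul_eq_mul, mul_assoc]
  refine mul_le_mul_of_nonneg_right ?_ (by positivity)
  exact_mod_cast card_le_univ _

end Achievability

/-! ### Perturbation of the rates and the inclusion of the region. -/

section Region

variable {𝒳₁ 𝒳₂ 𝒴₁ 𝒴₂ 𝒴ₑ : Type*} [Fintype 𝒳₁] [Fintype 𝒳₂]
  [Fintype 𝒴₁] [Fintype 𝒴₂] [Fintype 𝒴ₑ] {𝒬 : Type} [Fintype 𝒬]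
  {𝒯 : Aux → Type} [∀ i, Fintype (𝒯 i)]

/-- Achievability of rates with slack in the decoding conditions for error patterns that affect a
message, and in the conditions for approximating the output law at the eavesdropper. -/
theorem isAchievable_of_slack (W : Channel 𝒳₁ 𝒳₂ 𝒴₁ 𝒴₂ 𝒴ₑ)
    (pX₁ : 𝒯 .C₁ → 𝒯 .S₁ → 𝒯 .O₁ → 𝒬 → stdSimplex ℝ 𝒳₁)
    (pX₂ : 𝒯 .C₂ → 𝒯 .S₂ → 𝒯 .O₂ → 𝒬 → stdSimplex ℝ 𝒳₂)
    (pQ : stdSimplex ℝ 𝒬) (pT : ∀ i, 𝒬 → stdSimplex ℝ (𝒯 i)) {r rx : Aux → ℝ}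
    (hr : ∀ i, 0 ≤ r i) (hrx : ∀ i, 0 ≤ rx i) {η : ℝ} (hη : 0 < η) {D₁ D₂ : Finset Aux}
    (hD₁ : {.C₁, .S₁} ⊆ D₁) (hD₂ : {.C₂, .S₂} ⊆ D₂)
    (h₁ : ∀ S ⊆ D₁, (S ∩ ({.C₁, .S₁} : Finset Aux).filter (0 < r ·)).Nonempty →
      (∑ i ∈ S, (r i + rx i)) * Real.log 2 + 3 * η ≤
        logLikelihood pQ pT (layerChannel W pX₁ pX₂ fun y => y.1) D₁ -
          logLikelihood pQ pT (layerChannel W pX₁ pX₂ fun y => y.1) (D₁ \ S))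
    (h₂ : ∀ S ⊆ D₂, (S ∩ ({.C₂, .S₂} : Finset Aux).filter (0 < r ·)).Nonempty →
      (∑ i ∈ S, (r i + rx i)) * Real.log 2 + 3 * η ≤
        logLikelihood pQ pT (layerChannel W pX₁ pX₂ fun y => y.2.1) D₂ -
          logLikelihood pQ pT (layerChannel W pX₁ pX₂ fun y => y.2.1) (D₂ \ S))
    (hₑ : ∀ A : Finset Aux, A.Nonempty →
      logLikelihood pQ pT (layerChannel W pX₁ pX₂ fun y => y.2.2) A -
        logLikelihood pQ pT (layerChannel W pX₁ pX₂ fun y => y.2.2) ∅ + 2 * η ≤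
          ∑ i ∈ A, rx i * Real.log 2) :
    IsAchievable W (r .C₁ + r .S₁, r .C₂ + r .S₂) := by
  classical
  refine ⟨add_nonneg (hr _) (hr _), add_nonneg (hr _) (hr _), fun ε hε => ?_⟩
  have hlog2 : 0 < Real.log 2 := Real.log_pos one_lt_two
  obtain ⟨k₁, -, hk₁⟩ := exists_sum_not_decodingTest_le pQ pT
    (layerChannel W pX₁ pX₂ fun y => y.1) hη D₁ (({.C₁, .S₁} : Finset Aux).filter (0 < r ·))
  obtain ⟨k₂, -, hk₂⟩ := exists_sum_not_decodingTest_le pQ pT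
    (layerChannel W pX₁ pX₂ fun y => y.2.1) hη D₂ (({.C₂, .S₂} : Finset Aux).filter (0 < r ·))
  obtain ⟨k₃, -, hk₃⟩ := exists_sum_log_softCovering_le pQ pT
    (layerChannel W pX₁ pX₂ fun y => y.2.2) hη (fun i => rx i * Real.log 2)
    (fun i => mul_nonneg (hrx i) hlog2.le) hₑ
  set s : ℝ := Fintype.card (Finset Aux) * 4 ^ Fintype.card Aux with hs
  -- The weight `1 / (n * Real.log 2)` on the divergence turns nats per block into bits per channel
  -- use, so a bounded divergence contributes `O(1 / n)`.
  have hlim : Filter.Tendsto (fun n : ℕ => (k₁ / n + s * Real.exp (-(n * η))) +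
      (k₂ / n + s * Real.exp (-(n * η))) + 1 / (n * Real.log 2) * k₃) Filter.atTop (nhds 0) := by
    have hexp : Filter.Tendsto (fun n : ℕ => s * Real.exp (-((n : ℝ) * η))) Filter.atTop
        (nhds 0) := by
      have := (Real.tendsto_exp_neg_atTop_nhds_zero.comp
        ((tendsto_natCast_atTop_atTop (R := ℝ)).atTop_mul_const hη)).const_mul s
      simpa [Function.comp_def] using this
    have hl := tendsto_const_div_atTop_nhds_zero_nat (k₃ / Real.log 2)
    have := (((tendsto_const_div_atTop_nhds_zero_nat k₁).add hexp).add
      ((tendsto_const_div_atTop_nhds_zero_nat k₂).add hexp)).add hl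
    simp only [add_zero] at this
    refine this.congr fun n => ?_
    congr 1
    rw [one_div_mul_eq_div, div_div, mul_comm]
  obtain ⟨N, hN⟩ := Filter.eventually_atTop.1 (hlim.eventually_le_const hε)
  refine ⟨max N 1, fun n hn => ?_⟩
  have hn0 : 0 < n := lt_of_lt_of_le one_pos ((le_max_right _ _).trans hn)
  have hn' : (0 : ℝ) < n := Nat.cast_pos.2 hn0
  have hle := hN n ((le_max_left _ _).trans hn)
  have : ∀ x : ℝ, NeZero ⌈(2 : ℝ) ^ ((n : ℝ) * x)⌉₊ := fun x => ⟨(ceil_two_rpow_pos n x).ne'⟩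
  obtain ⟨a₁, ha₁⟩ := exists_messageIndex n r (u := .C₁) (v := .S₁) (by decide) hr
  obtain ⟨a₂, ha₂⟩ := exists_messageIndex n r (u := .C₂) (v := .S₂) (by decide) hr
  obtain ⟨c, hc₁, hc₂, hc₃⟩ := exists_secretCode (n := n)
    (α := fun i => Fin ⌈(2 : ℝ) ^ ((n : ℝ) * r i)⌉₊)
    (β := fun i => Fin ⌈(2 : ℝ) ^ ((n : ℝ) * rx i)⌉₊) W pX₁ pX₂ pQ pT a₁ a₂
    ((filter_subset _ _).trans hD₁) ((filter_subset _ _).trans hD₂)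
    ((filter_subset _ _).trans (by decide))
    (disjoint_of_subset_left (filter_subset _ _) (by decide)) ha₁ ha₂
    (decodingThreshold pQ pT (layerChannel W pX₁ pX₂ fun y => y.1) n η D₁)
    (decodingThreshold pQ pT (layerChannel W pX₁ pX₂ fun y => y.2.1) n η D₂)
    (hk₁ n hn0) (hk₂ n hn0) (sum_errorPattern_le pQ pT _ hr hrx h₁ n)
    (sum_errorPattern_le pQ pT _ hr hrx h₂ n)
    (hk₃ n hn0 _ fun i => by simpa using le_ceil_two_rpow (n := n) (rx i))
    (κ := 1 / (n * Real.log 2)) (by positivity)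
  refine ⟨c, max_le (hc₁.trans hle) (hc₂.trans hle), le_trans ?_ (hc₃.trans hle)⟩
  -- Rounding up makes the message entropy at least `n` times the rate, so the rate deficit is at
  -- most the leakage per channel use.
  have hM : ∀ x : ℝ, n * (x * Real.log 2) ≤ Real.log ⌈(2 : ℝ) ^ ((n : ℝ) * x)⌉₊ := fun x => by
    rw [Real.le_log_iff_exp_le (Nat.cast_pos.2 (ceil_two_rpow_pos n x))]
    exact le_ceil_two_rpow x
  rw [Real.log_mul (Nat.cast_ne_zero.2 (ceil_two_rpow_pos n _).ne')
    (Nat.cast_ne_zero.2 (ceil_two_rpow_pos n _).ne')]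
  have e : ∀ x y H : ℝ, x + y - 1 / n * H = 1 / (n * Real.log 2) *
      (n * (x * Real.log 2) + n * (y * Real.log 2) - H * Real.log 2) := by
    intro x y H; field_simp
  rw [e]
  refine mul_le_mul_of_nonneg_left (sub_le_sub_right (add_le_add (hM _) (hM _)) _) (by positivity)

/-- Lowering message rates and raising randomization rates makes room in every decoding condition
for a pattern that affects a message. -/
lemma sum_perturbed_add_le {r rx : Aux → ℝ} (hr : ∀ i, 0 ≤ r i) {δ : ℝ} (hδ : 0 < δ)
    {S : Finset Aux} {i : Aux} (hi : i ∈ S) (hpos : 0 < max (r i - 7 * δ) 0) :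
    ∑ j ∈ S, (max (r j - 7 * δ) 0 + (rx j + δ)) + δ ≤ ∑ j ∈ S, (r j + rx j) := by
  have hterm : ∀ j ∈ S, max (r j - 7 * δ) 0 + (rx j + δ) ≤
      (r j + rx j) + δ - (if j = i then 7 * δ else 0) := by
    intro j _
    split_ifs with hj
    · subst hj
      rw [max_eq_left_of_lt (by_contra fun h => by
        rw [max_eq_right (by linarith)] at hpos; exact lt_irrefl _ hpos)]
      linarith
    · have : max (r j - 7 * δ) 0 ≤ r j := max_le (by linarith) (hr j)
      linarith
  have h := sum_le_sum hterm
  rw [sum_sub_distrib, sum_add_distrib (f := fun j => r j + rx j), sum_ite_eq' S i, if_pos hi,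
    sum_const, nsmul_eq_mul] at h
  -- The randomization rates add at most `6 * δ` over the six layers, and the message layer `i`
  -- gives back `7 * δ`.
  have hcard : (S.card : ℝ) ≤ 6 := by
    have : S.card ≤ 6 := (card_le_univ S).trans (by decide)
    exact_mod_cast this
  nlinarith

/-- Every rate pair of `ℛ(p)` is a limit of achievable pairs. -/
theorem rateRegion_subset_secrecyCapacityRegion {W : Channel 𝒳₁ 𝒳₂ 𝒴₁ 𝒴₂ 𝒴ₑ}
    {p : stdSimplex ℝ (JointAlphabet 𝒬 𝒯 𝒳₁ 𝒳₂ 𝒴₁ 𝒴₂ 𝒴ₑ)} (hp : IsAdmissible W p) :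
    rateRegion p ⊆ secrecyCapacityRegion W := by
  obtain ⟨pQ, pT, pX₁, pX₂, hp⟩ := hp
  refine closure_minimal ?_ isClosed_closure
  rintro R ⟨r, rx, hR₁, hR₂, -, -, h₁, h₂, ⟨hₑ, hsum⟩, hr, hrx⟩
  have hlog2 : 0 < Real.log 2 := Real.log_pos one_lt_two
  let r' : ℝ → Aux → ℝ := fun δ i => max (r i - 7 * δ) 0
  have hlim : Filter.Tendsto (fun δ : ℝ => (r' δ .C₁ + r' δ .S₁, r' δ .C₂ + r' δ .S₂))
      (nhdsWithin 0 (Set.Ioi 0)) (nhds R) := by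
    have hc : Continuous fun δ : ℝ => (r' δ .C₁ + r' δ .S₁, r' δ .C₂ + r' δ .S₂) := by
      simp only [r']; fun_prop
    have h0 : (r' 0 .C₁ + r' 0 .S₁, r' 0 .C₂ + r' 0 .S₂) = R := by
      simp [r', hr, ← hR₁, ← hR₂]
    have := hc.tendsto 0
    rw [h0] at this
    exact this.mono_left nhdsWithin_le_nhds
  refine mem_closure_of_tendsto hlim ?_
  filter_upwards [self_mem_nhdsWithin] with δ hδ
  have hδ : 0 < δ := hδ
  -- With this `η`, the slack `3 * η` in the decoding conditions is exactly `δ` in bits, and the `2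
  -- * η` at the eavesdropper is below it.
  have hη : 0 < δ * Real.log 2 / 3 := by positivity
  refine isAchievable_of_slack W pX₁ pX₂ pQ pT (r := r' δ) (rx := fun i => rx i + δ)
    (fun i => le_max_right _ _) (fun i => add_nonneg (hrx i) hδ.le) hη
    (D₁ := {.C₁, .S₁, .C₂, .O₂}) (D₂ := {.C₁, .O₁, .C₂, .S₂}) (by decide) (by decide)
    ?_ ?_ ?_
  · rintro S hS ⟨i, hi⟩
    simp only [mem_inter, mem_filter] at hi
    rw [← auxInfo_mul_log_two hp (fun y => y.1) _ S hS]
    have h := (sum_perturbed_add_le (rx := rx) hr hδ hi.1 hi.2.2).trans (h₁ S hS)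
    have := mul_le_mul_of_nonneg_right h hlog2.le
    simp only [r']
    linarith
  · rintro S hS ⟨i, hi⟩
    simp only [mem_inter, mem_filter] at hi
    rw [← auxInfo_mul_log_two hp (fun y => y.2.1) _ S hS]
    have h := (sum_perturbed_add_le (rx := rx) hr hδ hi.1 hi.2.2).trans (h₂ S hS)
    have := mul_le_mul_of_nonneg_right h hlog2.le
    simp only [r']
    linarith
  · intro A hA
    -- Since `A` is nonempty, the eavesdropper's condition applies to the proper subset `Aᶜ`.
    -- Subtracting it from the sum equality turns the upper bound on `Aᶜ` into the lower bound on
    -- `A` that resolvability needs.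
    have hAc : Aᶜ ⊂ univ := by
      rw [ssubset_univ_iff]
      intro h
      rw [compl_eq_univ_iff] at h
      exact hA.ne_empty h
    have e1 := auxInfo_mul_log_two hp (fun y => y.2.2) univ Aᶜ (subset_univ _)
    rw [sdiff_compl] at e1
    simp only [inf_eq_inter, univ_inter] at e1
    have e2 := condMutualInfo_layers_mul_log_two hp (fun y => y.2.2)
    rw [← hsum, ← sum_add_sum_compl A] at e2
    have e3 := mul_le_mul_of_nonneg_right (hₑ Aᶜ hAc) hlog2.le
    have e4 : ∑ i ∈ A, (rx i + δ) * Real.log 2 = (∑ i ∈ A, rx i) * Real.log 2 +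
        A.card * (δ * Real.log 2) := by
      rw [← sum_mul, sum_add_distrib, sum_const, nsmul_eq_mul]; ring
    have e5 : δ * Real.log 2 ≤ A.card * (δ * Real.log 2) := by
      have : (1 : ℝ) ≤ A.card := by exact_mod_cast hA.card_pos
      exact le_mul_of_one_le_left (by positivity) this
    rw [e4]
    have : 0 < δ * Real.log 2 := by positivity
    linarith

end Region

theorem theorem1 {𝒳₁ 𝒳₂ 𝒴₁ 𝒴₂ 𝒴ₑ : Type*} [Fintype 𝒳₁] [Fintype 𝒳₂]
    [Fintype 𝒴₁] [Fintype 𝒴₂] [Fintype 𝒴ₑ] (W : Channel 𝒳₁ 𝒳₂ 𝒴₁ 𝒴₂ 𝒴ₑ) :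
    closure (rateRegionUnion W) ⊆ secrecyCapacityRegion W := by
  refine closure_minimal ?_ isClosed_closure
  rintro R ⟨𝒬, _, 𝒯, _, p, hp, hR⟩
  exact rateRegion_subset_secrecyCapacityRegion hp hR
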